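/- **Setting.** Fix variables, values (each value is also a constant expression), data operators with an interpretation, a notion of truth of values, action labels, and a label $\tau$ (the silent action is $\tau$ without parameters). *Expressions* are built from values, variables and operators; *action terms* are $a(e_1,\dots,e_n)$, of signature $(a,n)$. A *sort* is a set of signatures; the signature of $\tau$ counts as a member of every sort. Predicates are taken up to logical equivalence (sets of valuations); equations between terms are evaluated under valuations. For substitutions, $(\sigma_2\otimes\sigma_1)(x)=\sigma_2(x)\{\!\{\sigma_1\}\!\}$. **pNets.** A *pLTS* has states with an initial state, a set $V$ of variables, and transitions $s\xrightarrow{\langle\alpha,e_b,(x_j:=e_j)_j\rangle}s'$, where the parameters of $\alpha$ are expressions or input variables $?x$ (occurring nowhere else in $\alpha$), with $\mathrm{vars}(\alpha)\setminus\mathrm{iv}(\alpha)\subseteq V$, $\mathrm{vars}(e_b)\subseteq V\cup\mathrm{vars}(\alpha)$, $x_j\in V$, $\mathrm{vars}(e_j)\subseteq V\cup \mathrm{iv}(\alpha)$. A *pNet* is a pLTS or a node $\langle P_i^{i\in I},\mathrm{Sort}_j^{j\in J},\mathrm{SV}\rangle$ with sub-pNets $P_i$, own holes $j\in J$ of sort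 $\mathrm{Sort}_j$, and a set of synchronisation vectors $(\alpha_l)^{l\in M}\to\alpha'[e_b]$ (guard $e_b$), where $I\cap J=\emptyset\ne I\cup J$, $M\subseteq I\cup J$, the signature of $\alpha_l$ is in the sort of $P_l$ or in $\mathrm{Sort}_l$, and the variables of $\alpha'$ and $e_b$ occur in the $\alpha_l$; the sets $\mathrm{vars}(P_i)$ are pairwise disjoint, and so are $J$ and the sets $\mathrm{Holes}(P_i)$. Here $\mathrm{vars}$ and $\mathrm{Holes}$ collect the variables of all pLTSs and the holes at all levels, and the sort of a pLTS (node) is the set of signatures of its transitions (of the results of its vectors). For a set $K\subseteq J$, $P[Q_k]^{k\in K}$ is the node in which each hole $k\in K$ has become the sub-pNet $Q_k$. **Semantics.** A state of a pNet is a tuple of states of its leaf pLTSs. An *open transition* (OT) consists of states $s,s'$, hole actions $\beta_j^{j\in J'}$, a predicate, an assignment $\mathrm{Post}$ of expressions to state variables, and a resulting action $\alpha$. The OTs of a pNet are given by the following rules and by closure, at every level, under substitution of variables that are not variables of the pNet and under strengthening of the predicate. (pLTS) A transition as above gives the OT with no hole action, action $\alpha$ without input markers, predicate $e_b$, and $\mathrm{Post}=(x_j\leftarrow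 e_j)_j$. (Node) For a vector $(\alpha'_l)^{l\in M}\to\alpha'[e_b]$, with its variables renamed or instantiated, take an OT of $P_i$ with action $\alpha_i$ for each $i\in M\cap I$ and an action $\beta_j$ with signature in $\mathrm{Sort}_j$ for each $j\in M\cap J$; the resulting OT has an action $\alpha$, the hole actions of these OTs together with the $\beta_j$, the union of the assignments, and as predicate the conjunction of the predicates of the OTs with $\alpha_i=\alpha'_i$, $\beta_j=\alpha'_j$, $\alpha=\alpha'$ and $e_b$; the other sub-pNets do not move. **Weak transitions.** A *weak open transition* (WOT) has sequences $\gamma_j$ of hole actions in place of the $\beta_j$; its domain is the set of $j$ with $\gamma_j\neq[\,]$. Put $(\beta)^\nabla=[\,]$ if $\beta=\tau$ or $\beta$ is absent, and $(\beta)^\nabla=[\beta]$ otherwise. WOTs are generated by: $s\overset{\tau}{\Rightarrow}s$ with no hole action, predicate True and identity assignment; each OT with $\beta_j$ replaced by $(\beta_j)^\nabla$; and the composition of $s\overset{\tau}{\Rightarrow}s_1\overset{\alpha}{\Rightarrow}s_2\overset{\tau}{\Rightarrow}s'$ with components $(\gamma_i,\mathrm{Pred}_i,\mathrm{Post}_i)_{i=1,2,3}$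 into $s\Rightarrow s'$ with action $\alpha\{\!\{\mathrm{Post}_1\}\!\}$, hole sequences $\gamma_1\cdot\gamma_2\{\!\{\mathrm{Post}_1\}\!\}\cdot\gamma_3\{\!\{\mathrm{Post}_2\otimes\mathrm{Post}_1\}\!\}$, predicate $\mathrm{Pred}_1\wedge\mathrm{Pred}_2\{\!\{\mathrm{Post}_1\}\!\}\wedge\mathrm{Pred}_3\{\!\{\mathrm{Post}_2\otimes\mathrm{Post}_1\}\!\}$ and assignment $\mathrm{Post}_3\otimes\mathrm{Post}_2\otimes\mathrm{Post}_1$. **Weak FH-bisimilarity.** Two pNets with disjoint sets of variables and the same holes (at all levels) of the same sorts are *weak FH-bisimilar* if one can choose for all states $s,t$ of the first and second pNet a predicate $\mathrm{Pred}_{s,t}$ over their variables such that $\mathrm{Pred}$ is True at the pair of initial states and, for all $s,t$: for each OT $s\xrightarrow{\alpha}s'$ of the first with data $(\beta_j^{j\in J'},\mathrm{Pred}_{OT},\mathrm{Post}_{OT})$ there is a family of WOTs $t\overset{\alpha_x}{\Rightarrow}t_x$, $x\in X$, of the second, with data $(\gamma_{jx}^{j\in J_x},\mathrm{Pred}_x,\mathrm{Post}_x)$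 and $J_x=\{j\in J'\mid\beta_j\ne\tau\}$, such that for all valuations $$\mathrm{Pred}_{s,t}\wedge\mathrm{Pred}_{OT}\implies\bigvee_{x\in X}\Big(\forall j\in J_x.\,(\beta_j)^\nabla=\gamma_{jx}\;\wedge\;\mathrm{Pred}_x\;\wedge\;\alpha=\alpha_x\;\wedge\;\mathrm{Pred}_{s',t_x}\{\!\{\mathrm{Post}_{OT}\uplus\mathrm{Post}_x\}\!\}\Big),$$ and symmetrically for each OT of the second. A node *cannot observe silent actions* if for each $i\in I\cup J$ it has a vector $(i\mapsto\tau)\to\tau$ with an always true guard, and every vector in which some hole $j\in J$ does $\tau$ has $\tau$ as result and involves only $j$; a pLTS satisfies this vacuously. **Theorem (Composability of weak bisimulation).** Let $P$ and $P'$ be weak FH-bisimilar pNets that cannot observe silent actions. Let $K$ be a set of holes that are own holes both of $P$ and of $P'$, such that each synchronisation vector of the root of $P$ or of $P'$ involves only finitely many holes of $K$ (for example, $K$ finite). For each $k\in K$ let $Q_k$ and $Q'_k$ be weak FH-bisimilar pNets whose sorts are, up to $\tau$, the sort of the hole $k$ in $P$ and in $P'$ respectively. Suppose that the compositions $P[Q_k]^{k\in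 K}$ and $P'[Q'_k]^{k\in K}$ are pNets (i.e. satisfy the conditions above on names of variables and holes, sorts and vectors) and that their sets of variables are disjoint. Then $P[Q_k]^{k\in K}$ and $P'[Q'_k]^{k\in K}$ are weak FH-bisimilar. -/

import Mathlib

universe u v w

namespace Pnet

section

/-! ### Term algebra -/

/-- The unspecified term algebra: variables, values, data operators with their interpretation,
the truth of (boolean) values, action labels, and the label of the silent action. -/
structure TermAlgebra where
  Var : Type u
  Val : Type u
  Op : Type u
  arity : Op → ℕ
  interp : (f : Op) → (Fin (arity f) → Val) → Val
  IsTrue : Val → Prop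
  Lab : Type u
  tau : Lab

/-- Expressions: values, variables, and operators applied to expressions. -/
inductive Expr (A : TermAlgebra.{u}) : Type u
  | val : A.Val → Expr A
  | var : A.Var → Expr A
  | op : (f : A.Op) → (Fin (A.arity f) → Expr A) → Expr A

/-- Valuations of the variables. -/
abbrev Valuation (A : TermAlgebra.{u}) := A.Var → A.Val

/-- (Parallel) substitutions; a variable outside the domain is mapped to itself. -/
abbrev Subst (A : TermAlgebra.{u}) := A.Var → Expr A

/-- Predicates up to logical equivalence, i.e. sets of valuations. -/
abbrev Pred (A : TermAlgebra.{u}) := Valuation A → Prop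

variable {A : TermAlgebra.{u}}

def Expr.vars : Expr A → Set A.Var
  | .val _ => ∅
  | .var x => {x}
  | .op _ es => ⋃ i, (es i).vars

def Expr.eval (ρ : Valuation A) : Expr A → A.Val
  | .val c => c
  | .var x => ρ x
  | .op f es => A.interp f fun i => (es i).eval ρ

def Expr.subst (σ : Subst A) : Expr A → Expr A
  | .val c => .val c
  | .var x => σ x
  | .op f es => .op f fun i => (es i).subst σ

/-- The guard `e` is true under `ρ`. -/
def Expr.Holds (e : Expr A) (ρ : Valuation A) : Prop := A.IsTrue (e.eval ρ)

/-- The valuation reached from `ρ` by the simultaneous assignments `σ`. -/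
def Valuation.after (ρ : Valuation A) (σ : Subst A) : Valuation A := fun x => (σ x).eval ρ

/-- The identity substitution. -/
def Subst.id : Subst A := Expr.var

/-- `σ₂ ⊗ σ₁`: the effect of `σ₁` followed by `σ₂`, that is `x ← σ₂(x){{σ₁}}`. -/
def Subst.comp (σ₂ σ₁ : Subst A) : Subst A := fun x => (σ₂ x).subst σ₁

/-- `φ{{σ}}`. -/
def Pred.subst (φ : Pred A) (σ : Subst A) : Pred A := fun ρ => φ (ρ.after σ)

open Classical in
/-- `σ₁ ⊎ σ₂`, for `σ₁` acting on `V₁` and `σ₂` acting on `V₂`. -/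
noncomputable def Subst.union (V₁ : Set A.Var) (σ₁ : Subst A) (V₂ : Set A.Var) (σ₂ : Subst A) :
    Subst A :=
  fun x => if x ∈ V₁ then σ₁ x else if x ∈ V₂ then σ₂ x else Expr.var x

/-- Action terms `a(e₁,…,eₙ)` without input markers. -/
structure Action (A : TermAlgebra.{u}) : Type u where
  lab : A.Lab
  args : List (Expr A)

/-- Action signatures: a label and an arity. -/
abbrev ASig (A : TermAlgebra.{u}) := A.Lab × ℕ

/-- The silent action, a label without parameters. -/
def tauAct (A : TermAlgebra.{u}) : Action A := ⟨A.tau, []⟩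

def tauSig (A : TermAlgebra.{u}) : ASig A := (A.tau, 0)

def Action.sig (a : Action A) : ASig A := (a.lab, a.args.length)

def Action.vars (a : Action A) : Set A.Var := {x | ∃ e ∈ a.args, x ∈ e.vars}

def Action.subst (a : Action A) (σ : Subst A) : Action A := ⟨a.lab, a.args.map (Expr.subst σ)⟩

/-- The ground action denoted by an action term under a valuation; `a = b` holds under `ρ`
iff `a.eval ρ = b.eval ρ`. -/
def Action.eval (ρ : Valuation A) (a : Action A) : A.Lab × List A.Val :=
  (a.lab, a.args.map (Expr.eval ρ))

/-- Parameters of the actions of a pLTS: input variables `?x` or expressions. -/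
inductive Param (A : TermAlgebra.{u}) : Type u
  | inp : A.Var → Param A
  | exp : Expr A → Param A

/-- The expression left when the input marker is removed. -/
def Param.toExpr : Param A → Expr A
  | .inp x => .var x
  | .exp e => e

/-- Action terms with input variables. -/
structure InAction (A : TermAlgebra.{u}) : Type u where
  lab : A.Lab
  params : List (Param A)

def InAction.toAction (a : InAction A) : Action A := ⟨a.lab, a.params.map Param.toExpr⟩

def InAction.iv (a : InAction A) : Set A.Var := {x | Param.inp x ∈ a.params}

/-- An input variable occurs nowhere else in its action term. -/
def InAction.Linear (a : InAction A) : Prop :=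
  a.params.Pairwise fun p q =>
    (∀ x, p = .inp x → x ∉ q.toExpr.vars) ∧ (∀ x, q = .inp x → x ∉ p.toExpr.vars)

/-! ### pLTSs and pNets -/

/-- Labels `⟨α, e_b, (x_j := e_j)⟩`; a variable that is not assigned is mapped to itself. -/
structure PLabel (A : TermAlgebra.{u}) : Type u where
  act : InAction A
  guard : Expr A
  assign : Subst A

/-- Parameterised labelled transition systems. -/
structure PLTS (A : TermAlgebra.{u}) where
  St : Type w
  init : St
  V : Set A.Var
  tr : St → PLabel A → St → Prop
  linear : ∀ s l s', tr s l s' → l.act.Linear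
  act_vars : ∀ s l s', tr s l s' → l.act.toAction.vars \ l.act.iv ⊆ V
  guard_vars : ∀ s l s', tr s l s' → l.guard.vars ⊆ V ∪ l.act.toAction.vars
  assign_vars : ∀ s l s', tr s l s' → ∀ x, l.assign x ≠ Expr.var x →
    x ∈ V ∧ (l.assign x).vars ⊆ V ∪ l.act.iv

/-- Synchronisation vectors: the actions of the involved sub-pNets and holes (a partial map),
the resulting global action, and a guard. -/
structure SyncVec (A : TermAlgebra.{u}) (Idx : Type v) where
  comp : Idx → Option (Action A)
  res : Action A
  guard : Expr A

/-- The variables of the component actions of a vector. -/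
def SyncVec.compVars {Idx : Type v} (sv : SyncVec A Idx) : Set A.Var :=
  {x | ∃ l a, sv.comp l = some a ∧ x ∈ a.vars}

/-- Raw pNets: a pLTS, or a node with sub-pNets `sub i` (`i ∈ I`), holes `j ∈ J` of sort `srt j`,
and a set of synchronisation vectors. Only the values of `sub` on `I` and of `srt` on `J` matter.
The side conditions are in `PNet.WF`. -/
inductive PNet (A : TermAlgebra.{u}) (Idx : Type v) : Type (max u v (w + 1))
  | lts : PLTS.{u, w} A → PNet A Idx
  | node : (I J : Set Idx) → (sub : Idx → PNet A Idx) → (srt : Idx → Set (ASig A)) →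
      (SV : Set (SyncVec A Idx)) → PNet A Idx

variable {Idx : Type v}

namespace PNet

/-- The sort (signature) of a pNet. -/
def sort : PNet.{u, v, w} A Idx → Set (ASig A)
  | lts L => {g | ∃ s l s', L.tr s l s' ∧ l.act.toAction.sig = g}
  | node _ _ _ _ SV => {g | ∃ sv ∈ SV, sv.res.sig = g}

/-- The variables of a pNet: those of all its pLTSs. -/
def vars : PNet.{u, v, w} A Idx → Set A.Var
  | lts L => L.V
  | node I _ sub _ _ => {x | ∃ i ∈ I, x ∈ (sub i).vars}

/-- All holes of a pNet (its own and those of its sub-pNets), each with its sort. -/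
def holes : PNet.{u, v, w} A Idx → Set (Idx × Set (ASig A))
  | lts _ => ∅
  | node I J sub srt _ => {h | (h.1 ∈ J ∧ h.2 = srt h.1) ∨ ∃ i ∈ I, h ∈ (sub i).holes}

/-- The indices of all holes of a pNet. -/
def holeIdx (P : PNet.{u, v, w} A Idx) : Set Idx := Prod.fst '' P.holes

/-- The holes that belong to the root node of the pNet, i.e. those that composition can fill. -/
def ownHoles : PNet.{u, v, w} A Idx → Set Idx
  | lts _ => ∅
  | node _ J _ _ _ => J

/-- The sorts of the holes of the root node. -/
def ownSort : PNet.{u, v, w} A Idx → Idx → Set (ASig A)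
  | lts _ => fun _ => ∅
  | node _ _ _ srt _ => srt

/-- The synchronisation vectors of the root node. -/
def vectors : PNet.{u, v, w} A Idx → Set (SyncVec A Idx)
  | lts _ => ∅
  | node _ _ _ _ SV => SV

/-- Well-formed pNets. The silent action counts as a member of every sort, so that the vectors
`(i ↦ τ) → τ` make sense at every position `i`. -/
def WF : PNet.{u, v, w} A Idx → Prop
  | lts _ => True
  | node I J sub srt SV =>
      Disjoint I J ∧ (I ∪ J).Nonempty ∧
      (∀ i ∈ I, (sub i).WF) ∧
      (∀ i ∈ I, ∀ i' ∈ I, i ≠ i' → Disjoint (sub i).vars (sub i').vars) ∧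
      (∀ i ∈ I, Disjoint (sub i).holeIdx J) ∧
      (∀ i ∈ I, ∀ i' ∈ I, i ≠ i' → Disjoint (sub i).holeIdx (sub i').holeIdx) ∧
      ∀ sv ∈ SV,
        (∀ l a, sv.comp l = some a →
          (l ∈ I ∧ a.sig ∈ insert (tauSig A) (sub l).sort) ∨
          (l ∈ J ∧ a.sig ∈ insert (tauSig A) (srt l))) ∧
        sv.res.vars ⊆ sv.compVars ∧ sv.guard.vars ⊆ sv.compVars

open Classical in
/-- `P[Q_k]^{k ∈ K}`: the holes `k ∈ K` of the root node of `P` become the sub-pNets `Q k`.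
For `K = {j₀}` this is `P[Q]_{j₀}`; several holes can be filled together or one by one. -/
noncomputable def fill (P : PNet.{u, v, w} A Idx) (K : Set Idx) (Q : Idx → PNet.{u, v, w} A Idx) :
    PNet.{u, v, w} A Idx :=
  match P with
  | lts L => lts L
  | node I J sub srt SV => node (I ∪ K) (J \ K) (fun i => if i ∈ K then Q i else sub i) srt SV

/-- Non-observability of silent actions: at every position `i` the vector `(i ↦ τ) → τ` with a
true guard is present, and a vector in which a hole does `τ` involves nothing else and results
in `τ`. A pLTS has no position at all. -/
def CannotObserveSilent : PNet.{u, v, w} A Idx → Prop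
  | lts _ => True
  | node I J _ _ SV =>
      (∀ i ∈ I ∪ J, ∃ sv ∈ SV, sv.comp i = some (tauAct A) ∧ (∀ l, l ≠ i → sv.comp l = none) ∧
        sv.res = tauAct A ∧ ∀ ρ, sv.guard.Holds ρ) ∧
      ∀ sv ∈ SV, ∀ j ∈ J, sv.comp j = some (tauAct A) →
        sv.res = tauAct A ∧ ∀ l, sv.comp l ≠ none → l = j

/-- States of a pNet: tuples of states of its leaves. -/
def State : PNet.{u, v, w} A Idx → Type (max v w)
  | lts L => ULift.{v} L.St
  | node I _ sub _ _ => (i : I) → (sub i).State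

/-- The initial state. -/
def initState : (P : PNet.{u, v, w} A Idx) → P.State
  | lts L => ULift.up L.init
  | node _ _ sub _ _ => fun i => (sub i).initState

end PNet

/-! ### Open automata -/

/-- Open transitions: `hole` is the family of hole actions (a partial map), `act` the resulting
action, `pred` the predicate, and `post` the assignments. -/
structure OT (A : TermAlgebra.{u}) (Idx : Type v) (S : Type w) where
  src : S
  hole : Idx → Option (Action A)
  pred : Pred A
  post : Subst A
  act : Action A
  dst : S

open Classical in
/-- Refinement of an open transition over the variables `V`: free variables are substituted
by `σ` and the predicate is strengthened by `φ`. -/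
noncomputable def OT.refine {S : Type w} (V : Set A.Var) (σ : Subst A) (φ : Pred A)
    (t : OT A Idx S) : OT A Idx S where
  src := t.src
  hole := fun j => (t.hole j).map fun b => b.subst σ
  pred := fun ρ => t.pred.subst σ ρ ∧ φ ρ
  post := fun x => if x ∈ V then (t.post x).subst σ else Expr.var x
  act := t.act.subst σ
  dst := t.dst

/-- Closure under refinement: substitutions that leave `V` alone, and arbitrary predicates. -/
def saturate {S : Type w} (V : Set A.Var) (T : Set (OT A Idx S)) : Set (OT A Idx S) :=
  {t' | ∃ t ∈ T, ∃ (σ : Subst A) (φ : Pred A), (∀ x ∈ V, σ x = Expr.var x) ∧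
    t' = t.refine V σ φ}

/-- Open automata. The set of holes records the sorts of the holes. -/
structure OpenAutomaton (A : TermAlgebra.{u}) (Idx : Type v) where
  holes : Set (Idx × Set (ASig A))
  St : Type w
  init : St
  vars : Set A.Var
  trans : Set (OT A Idx St)
  hole_mem : ∀ t ∈ trans, ∀ j b, t.hole j = some b →
    ∃ g, (j, g) ∈ holes ∧ b.sig ∈ insert (tauSig A) g
  post_id : ∀ t ∈ trans, ∀ x, x ∉ vars → t.post x = Expr.var x
  closed : saturate vars trans ⊆ trans

/-! ### Semantics of pNets -/

/-- The rule for a pLTS. -/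
def ltsRule (L : PLTS.{u, w} A) : Set (OT A Idx (ULift.{v} L.St)) :=
  {t | ∃ s l s', L.tr s l s' ∧
    t = { src := ⟨s⟩, hole := fun _ => none, pred := l.guard.Holds, post := l.assign,
          act := l.act.toAction, dst := ⟨s'⟩ }}

/-- The rule for a pNet node, for the vector `sv` with its variables instantiated by `θ`, and open
transitions `c i` of the sub-pNets `i` that occur in `sv`. Vectors are given up to renaming of their
variables and open transitions are closed under substitution of free variables, so that choosing
fresh variables first amounts to an arbitrary instantiation `θ`. -/
structure NodeRule {I : Set Idx} {S : I → Type w} (J : Set Idx) (srt : Idx → Set (ASig A))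
    (cvars : I → Set A.Var) (choles : I → Set Idx) (ctrans : (i : I) → Set (OT A Idx (S i)))
    (sv : SyncVec A Idx) (θ : Subst A) (c : (i : I) → OT A Idx (S i))
    (t : OT A Idx ((i : I) → S i)) : Prop where
  child : ∀ i : I, sv.comp i ≠ none → c i ∈ ctrans i
  src_active : ∀ i : I, sv.comp i ≠ none → t.src i = (c i).src
  dst_active : ∀ i : I, sv.comp i ≠ none → t.dst i = (c i).dst
  dst_inactive : ∀ i : I, sv.comp i = none → t.dst i = t.src i
  own_hole : ∀ j ∈ J, (t.hole j ≠ none ↔ sv.comp j ≠ none)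
  own_hole_sort : ∀ j ∈ J, ∀ b, t.hole j = some b → b.sig ∈ insert (tauSig A) (srt j)
  sub_hole : ∀ i : I, sv.comp i ≠ none → ∀ j ∈ choles i, t.hole j = (c i).hole j
  no_hole : ∀ j, j ∉ J → (∀ i : I, sv.comp i ≠ none → j ∉ choles i) → t.hole j = none
  pred_iff : ∀ ρ, t.pred ρ ↔
    (∀ i : I, sv.comp i ≠ none → (c i).pred ρ) ∧
    (∀ (i : I) a, sv.comp i = some a → (c i).act.eval ρ = (a.subst θ).eval ρ) ∧
    (∀ j ∈ J, ∀ b a, t.hole j = some b → sv.comp j = some a → b.eval ρ = (a.subst θ).eval ρ) ∧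
    t.act.eval ρ = (sv.res.subst θ).eval ρ ∧
    (sv.guard.subst θ).Holds ρ
  post_active : ∀ i : I, sv.comp i ≠ none → ∀ x ∈ cvars i, t.post x = (c i).post x
  post_id : ∀ x, (∀ i : I, sv.comp i ≠ none → x ∉ cvars i) → t.post x = Expr.var x

namespace PNet

/-- The open transitions `t` with `P ⊨ t`: generated by the two rules and closed under
refinement. -/
def trans : (P : PNet.{u, v, w} A Idx) → Set (OT A Idx P.State)
  | lts L => saturate L.V (ltsRule L)
  | node I J sub srt SV =>
      saturate (node I J sub srt SV).vars
        {t : OT A Idx ((i : I) → (sub i).State) | ∃ sv ∈ SV, ∃ θ c,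
          NodeRule J srt (fun i => (sub i).vars) (fun i => (sub i).holeIdx)
            (fun i => (sub i).trans) sv θ c t}

end PNet

theorem Expr.subst_subst (σ τ : Subst A) (e : Expr A) :
    (e.subst σ).subst τ = e.subst (Subst.comp σ τ) := by
  induction e with
  | val c => rfl
  | var x => rfl
  | op f es ih => simp only [Expr.subst]; congr 1; funext i; exact ih i

theorem Expr.eval_subst (ρ : Valuation A) (σ : Subst A) (e : Expr A) :
    (e.subst σ).eval ρ = e.eval (ρ.after σ) := by
  induction e with
  | val c => rfl
  | var x => rfl
  | op f es ih => simp only [Expr.subst, Expr.eval]; congr 1; funext i; exact ih i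

theorem Action.subst_subst (σ τ : Subst A) (a : Action A) :
    (a.subst σ).subst τ = a.subst (Subst.comp σ τ) := by
  simp only [Action.subst, List.map_map]
  congr 1
  apply List.map_congr_left
  intro e _
  exact Expr.subst_subst σ τ e

theorem saturate_closed {S : Type w} (V : Set A.Var) (T : Set (OT A Idx S)) :
    saturate V (saturate V T) ⊆ saturate V T := by
  rintro _ ⟨_, ⟨t, ht, σ, φ, hσ, rfl⟩, τ, ψ, hτ, rfl⟩
  refine ⟨t, ht, Subst.comp σ τ, fun ρ => φ (ρ.after τ) ∧ ψ ρ, ?_, ?_⟩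
  · intro x hx
    simp [Subst.comp, hσ x hx, Expr.subst, hτ x hx]
  · have hafter : ∀ ρ : Valuation A, (ρ.after τ).after σ = ρ.after (Subst.comp σ τ) := by
      intro ρ; funext x
      simp only [Valuation.after, Subst.comp, Expr.eval_subst]
    unfold OT.refine
    congr 1
    · funext j
      simp only [Option.map_map]
      congr 1
      funext b
      exact Action.subst_subst σ τ b
    · funext ρ
      simp only [Pred.subst, hafter, and_assoc]
    · funext x
      by_cases hx : x ∈ V
      · simp [hx, Expr.subst_subst]
      · simp [hx]
    · exact Action.subst_subst σ τ t.act

namespace PNet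

theorem trans_closed (P : PNet.{u, v, w} A Idx) : saturate P.vars P.trans ⊆ P.trans := by
  cases P with
  | lts L => rw [trans]; exact saturate_closed L.V (ltsRule L)
  | node I J sub srt SV => rw [trans]; exact saturate_closed _ _

theorem trans_post_id (P : PNet.{u, v, w} A Idx) (t) (ht : t ∈ P.trans) (x) (hx : x ∉ P.vars) :
    t.post x = Expr.var x := by
  cases P with
  | lts L =>
    simp only [trans] at ht
    obtain ⟨t, _, σ, φ, _, rfl⟩ := ht
    exact if_neg hx
  | node I J sub srt SV =>
    rw [trans] at ht
    obtain ⟨t, _, σ, φ, _, rfl⟩ := ht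
    exact if_neg hx

theorem trans_hole_mem (P : PNet.{u, v, w} A Idx) : ∀ t ∈ P.trans, ∀ j b, t.hole j = some b →
    ∃ g, (j, g) ∈ P.holes ∧ b.sig ∈ insert (tauSig A) g := by
  have hsig : ∀ (a : Action A) (σ : Subst A), (a.subst σ).sig = a.sig := by
    intro a σ; simp [Action.subst, Action.sig]
  induction P with
  | lts L =>
    intro t ht j b hb
    simp only [trans] at ht
    obtain ⟨t, ⟨s, l, s', _, rfl⟩, σ, φ, _, rfl⟩ := ht
    simp [OT.refine] at hb
  | node I J sub srt SV ih =>
    intro t ht j b hb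
    rw [trans] at ht
    obtain ⟨t, ⟨sv, _, θ, c, h⟩, σ, φ, _, rfl⟩ := ht
    change Option.map _ (t.hole j) = some b at hb
    rw [Option.map_eq_some_iff] at hb
    obtain ⟨b, hb, rfl⟩ := hb
    rw [hsig]
    by_cases hj : j ∈ J
    · exact ⟨srt j, by rw [holes]; exact Or.inl ⟨hj, rfl⟩, h.own_hole_sort j hj b hb⟩
    · by_cases hc : ∀ i : I, sv.comp i ≠ none → j ∉ (sub i).holeIdx
      · rw [h.no_hole j hj hc] at hb; cases hb
      · push Not at hc
        obtain ⟨i, hi, hji⟩ := hc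
        rw [h.sub_hole i hi j hji] at hb
        obtain ⟨g, hg, hbg⟩ := ih i (c i) (h.child i hi) j b hb
        exact ⟨g, by rw [holes]; exact Or.inr ⟨i, i.2, hg⟩, hbg⟩

/-- The open automaton that is the semantics of a pNet. -/
def toAutomaton (P : PNet.{u, v, w} A Idx) : OpenAutomaton.{u, v, max v w} A Idx where
  holes := P.holes
  St := P.State
  init := P.initState
  vars := P.vars
  trans := P.trans
  hole_mem := P.trans_hole_mem
  post_id := P.trans_post_id
  closed := P.trans_closed

end PNet

/-! ### Weak open transitions and weak FH-bisimulation -/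

/-- Weak open transitions: each hole does a sequence of actions; the empty sequence means that the
hole is not in the domain of the family. -/
structure WOT (A : TermAlgebra.{u}) (Idx : Type v) (S : Type w) where
  src : S
  hole : Idx → List (Action A)
  pred : Pred A
  post : Subst A
  act : Action A
  dst : S

open Classical in
/-- The visible part of a hole action: a sequence of length at most one. -/
noncomputable def vis : Option (Action A) → List (Action A)
  | none => []
  | some b => if b = tauAct A then [] else [b]

/-- The weak open transitions derived from a set of open transitions. -/
inductive Weak {S : Type w} (T : Set (OT A Idx S)) : WOT A Idx S → Prop
  | refl (s : S) : Weak T ⟨s, fun _ => [], fun _ => True, Subst.id, tauAct A, s⟩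
  | lift (t : OT A Idx S) : t ∈ T →
      Weak T ⟨t.src, fun j => vis (t.hole j), t.pred, t.post, t.act, t.dst⟩
  | trans (w₁ w₂ w₃ : WOT A Idx S) : Weak T w₁ → Weak T w₂ → Weak T w₃ →
      w₁.act = tauAct A → w₃.act = tauAct A → w₁.dst = w₂.src → w₂.dst = w₃.src →
      Weak T
        { src := w₁.src
          hole := fun j => w₁.hole j ++ (w₂.hole j).map (fun b => b.subst w₁.post) ++
            (w₃.hole j).map (fun b => b.subst (Subst.comp w₂.post w₁.post))
          pred := fun ρ => w₁.pred ρ ∧ w₂.pred.subst w₁.post ρ ∧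
            w₃.pred.subst (Subst.comp w₂.post w₁.post) ρ
          post := Subst.comp w₃.post (Subst.comp w₂.post w₁.post)
          act := w₂.act.subst w₁.post
          dst := w₃.dst }

/-- Every open transition of `A₁` is covered by weak open transitions of `A₂`, where the predicate
`R s t` says when the states `s` and `t` are related. -/
def WeakSimulates (A₁ A₂ : OpenAutomaton.{u, v, w} A Idx) (R : A₁.St → A₂.St → Pred A) : Prop :=
  ∀ (t : A₂.St), ∀ o ∈ A₁.trans, ∃ X : Set (WOT A Idx A₂.St),
    (∀ x ∈ X, Weak A₂.trans x ∧ x.src = t ∧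
      {j | ∃ b, o.hole j = some b ∧ b ≠ tauAct A} = {j | x.hole j ≠ []}) ∧
    ∀ ρ : Valuation A, R o.src t ρ → o.pred ρ → ∃ x ∈ X,
      (∀ j, x.hole j ≠ [] →
        (vis (o.hole j)).map (Action.eval ρ) = (x.hole j).map (Action.eval ρ)) ∧
      x.pred ρ ∧ o.act.eval ρ = x.act.eval ρ ∧
      (R o.dst x.dst).subst (Subst.union A₁.vars o.post A₂.vars x.post) ρ

/-- `R` is a weak FH-bisimulation between two open automata with the same holes of the same sorts
and disjoint sets of variables; its predicates are over the variables of the two automata. -/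
structure IsWeakFHBisimulation (A₁ A₂ : OpenAutomaton.{u, v, w} A Idx)
    (R : A₁.St → A₂.St → Pred A) : Prop where
  holes_eq : A₁.holes = A₂.holes
  vars_disjoint : Disjoint A₁.vars A₂.vars
  over_vars : ∀ s t (ρ ρ' : Valuation A), (∀ x ∈ A₁.vars ∪ A₂.vars, ρ x = ρ' x) →
    (R s t ρ ↔ R s t ρ')
  forth : WeakSimulates A₁ A₂ R
  back : WeakSimulates A₂ A₁ fun t s => R s t

/-- Two pNets are weak FH-bisimilar: a weak FH-bisimulation between their automata has the
predicate True at the initial states. -/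
def WeakFHBisimilar (P P' : PNet.{u, v, w} A Idx) : Prop :=
  ∃ R : P.State → P'.State → Pred A,
    IsWeakFHBisimulation P.toAutomaton P'.toAutomaton R ∧ ∀ ρ, R P.initState P'.initState ρ

end

end Pnet

/-! Weak bisimilarity can be tested one valuation at a time. A valuation satisfying the predicate of
an open transition turns it into a ground step between pairs (state, valuation), and weak open
transitions become ground runs. The covering family may be taken as large as possible, and whether
an action term is silent does not depend on the valuation. Weak simulation is therefore ordinary
weak simulation of ground steps by ground runs (`weakSimulates_iff_groundSimulates`). By closure
under substitution only the values of the automaton's own variables matter (`Step.congr`), so steps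
of components with disjoint variables can be put side by side.

A ground step of a node is an evaluated vector together with steps of the sub-pNets it involves
(`nodeStep_of_step`, `step_of_nodeStep`). Hence a step of `P[Q]` splits into a step of `P`, in which
each hole `k` of `K` does what the vector prescribes, and steps of the nets `Q k` involved. The
bisimulation for the filled nets is the conjunction of the given ones. Then `P'` answers with a run,
each moving `Q k` is answered by a run of `Q' k`, and these runs must be merged into one run of
`P'[Q']`.

The merging (`Fillable.run_of_run`) uses both halves of non-observability. The run of `Q' k` for a
visible action is a step between two silent runs; the vectors `(k ↦ τ) → τ` let the silent parts run
before and after the step of `P'` that uses hole `k`. Only finitely many nets take part in one step,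
so this is a finite run. Conversely, `P'` may let a hole of `K` do `τ`, which leaves no trace in its
weak run and which no move of `Q' k` matches; such a step moves nothing and results in `τ`, so it is
dropped. If `Q k` itself does `τ`, the silent answer of `Q' k` is put in front of the run of `P'`.
-/

namespace Pnet

section

variable {A : TermAlgebra.{u}} {Idx : Type v}

/-! ### Ground actions and evaluation of terms -/

/-- Ground actions: a label applied to values. -/
abbrev GroundAction (A : TermAlgebra.{u}) := A.Lab × List A.Val

/-- The ground silent action. -/
def groundTau (A : TermAlgebra.{u}) : GroundAction A := (A.tau, [])

open Classical in
/-- The visible part of a ground hole action. -/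
noncomputable def groundVis : Option (GroundAction A) → List (GroundAction A)
  | none => []
  | some b => if b = groundTau A then [] else [b]

/-- A ground action as an action term. -/
def GroundAction.toAction (b : GroundAction A) : Action A := ⟨b.1, b.2.map Expr.val⟩

theorem GroundAction.eval_toAction (ρ : Valuation A) (b : GroundAction A) :
    b.toAction.eval ρ = b := by
  obtain ⟨l, vs⟩ := b
  simp only [GroundAction.toAction, Action.eval, List.map_map, Prod.mk.injEq, true_and]
  exact List.map_id'' (fun _ => rfl) vs

theorem Action.eval_tauAct (ρ : Valuation A) : (tauAct A).eval ρ = groundTau A := rfl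

/-- The silent action has no parameters, so being silent is a syntactic property. This lets runs
with ground action `τ` come from weak open transitions whose action term is `τ`, as their
composition requires. -/
theorem Action.eval_eq_groundTau {ρ : Valuation A} {a : Action A} :
    a.eval ρ = groundTau A ↔ a = tauAct A := by
  obtain ⟨l, as⟩ := a
  simp [Action.eval, groundTau, tauAct]

theorem Action.eval_subst (ρ : Valuation A) (σ : Subst A) (a : Action A) :
    (a.subst σ).eval ρ = a.eval (ρ.after σ) := by
  simp only [Action.eval, Action.subst, List.map_map, Prod.mk.injEq, true_and]
  exact List.map_congr_left fun e _ => Expr.eval_subst ρ σ e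

theorem Action.sig_toAction_of_eval {η : Valuation A} {a : Action A} :
    (GroundAction.toAction (a.eval η)).sig = a.sig := by
  simp [GroundAction.toAction, Action.sig, Action.eval]

theorem map_eval_vis (ρ : Valuation A) (b : Option (Action A)) :
    (vis b).map (Action.eval ρ) = groundVis (b.map (Action.eval ρ)) := by
  cases b with
  | none => rfl
  | some b =>
    by_cases hb : b = tauAct A
    · simp [vis, groundVis, hb, Action.eval_tauAct]
    · simp [vis, groundVis, hb, Action.eval_eq_groundTau]

theorem Valuation.after_id (ρ : Valuation A) : ρ.after Subst.id = ρ := rfl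

theorem Valuation.after_comp (ρ : Valuation A) (σ τ : Subst A) :
    ρ.after (Subst.comp σ τ) = (ρ.after τ).after σ := by
  funext x
  simp only [Valuation.after, Subst.comp, Expr.eval_subst]

open Classical in
/-- The function that is `f` on `V` and `g` elsewhere. -/
noncomputable def overlay {X β : Type*} (V : Set X) (f g : X → β) : X → β :=
  fun x => if x ∈ V then f x else g x

theorem overlay_of_mem {X β : Type*} {V : Set X} {f g : X → β} {x : X} (h : x ∈ V) :
    overlay V f g x = f x := if_pos h

theorem overlay_of_notMem {X β : Type*} {V : Set X} {f g : X → β} {x : X} (h : x ∉ V) :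
    overlay V f g x = g x := if_neg h

theorem overlay_eq_left {X β : Type*} {V : Set X} {f g : X → β} (h : ∀ x, x ∉ V → f x = g x) :
    overlay V f g = f := by
  funext x
  by_cases hx : x ∈ V
  · exact overlay_of_mem hx
  · rw [overlay_of_notMem hx, h x hx]

theorem Valuation.after_union (ρ : Valuation A) (V₁ V₂ : Set A.Var) (σ₁ σ₂ : Subst A) :
    ρ.after (Subst.union V₁ σ₁ V₂ σ₂) =
      overlay V₁ (ρ.after σ₁) (overlay V₂ (ρ.after σ₂) ρ) := by
  funext x
  simp only [Valuation.after, Subst.union, overlay]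
  split_ifs <;> rfl

/-! ### Ground steps and ground weak runs of an open automaton -/

namespace OpenAutomaton

variable (B : OpenAutomaton.{u, v, w} A Idx)

/-- The ground steps of an open automaton: the instances of its open transitions under
valuations that satisfy the predicate. -/
def Step (s : B.St) (ρ : Valuation A) (h : Idx → Option (GroundAction A)) (a : GroundAction A)
    (s' : B.St) (ρ' : Valuation A) : Prop :=
  ∃ o ∈ B.trans, o.src = s ∧ o.dst = s' ∧ o.pred ρ ∧
    (∀ j, (o.hole j).map (Action.eval ρ) = h j) ∧ o.act.eval ρ = a ∧ ρ.after o.post = ρ'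

/-- The ground weak runs of an open automaton. -/
inductive Run : B.St → Valuation A → (Idx → List (GroundAction A)) → GroundAction A →
    B.St → Valuation A → Prop
  | refl (s ρ) : Run s ρ (fun _ => []) (groundTau A) s ρ
  | lift {s ρ h a s' ρ'} : B.Step s ρ h a s' ρ' → Run s ρ (fun j => groundVis (h j)) a s' ρ'
  | trans {s ρ H₁ s₁ ρ₁ H₂ a s₂ ρ₂ H₃ s' ρ'} : Run s ρ H₁ (groundTau A) s₁ ρ₁ →
      Run s₁ ρ₁ H₂ a s₂ ρ₂ → Run s₂ ρ₂ H₃ (groundTau A) s' ρ' →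
      Run s ρ (fun j => H₁ j ++ H₂ j ++ H₃ j) a s' ρ'

variable {B}

theorem Step.hole_eq_none {s ρ h a s' ρ'} (hs : B.Step s ρ h a s' ρ') {j : Idx}
    (hj : j ∉ Prod.fst '' B.holes) : h j = none := by
  obtain ⟨o, ho, _, _, _, hh, _, _⟩ := hs
  rw [← hh]
  cases hb : o.hole j with
  | none => rfl
  | some b =>
    obtain ⟨g, hg, _⟩ := B.hole_mem o ho j b hb
    exact absurd ⟨_, hg, rfl⟩ hj

/-- A ground step depends only on the values of the variables of the automaton. -/
theorem Step.congr {s ρ h a s' ρ₁} (hs : B.Step s ρ h a s' ρ₁) {ρ' : Valuation A}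
    (hρ : ∀ x ∈ B.vars, ρ' x = ρ x) : B.Step s ρ' h a s' (overlay B.vars ρ₁ ρ') := by
  classical
  obtain ⟨o, ho, rfl, rfl, hp, hh, rfl, rfl⟩ := hs
  -- Free variables are frozen at their values under `ρ`; since `σ` fixes the automaton's variables,
  -- the refined transition is again available, and under `ρ'` it evaluates as the old one does
  -- under `ρ`.
  let σ : Subst A := fun x => if x ∈ B.vars then Expr.var x else Expr.val (ρ x)
  have hσ : ρ'.after σ = ρ := by
    funext x
    by_cases hx : x ∈ B.vars
    · simp [Valuation.after, σ, hx, Expr.eval, hρ x hx]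
    · simp [Valuation.after, σ, hx, Expr.eval]
  refine ⟨o.refine B.vars σ fun _ => True,
    B.closed ⟨o, ho, σ, _, fun x hx => if_pos hx, rfl⟩, rfl, rfl, ⟨?_, trivial⟩, ?_, ?_, ?_⟩
  · rw [Pred.subst, hσ]; exact hp
  · intro j
    rw [← hh]
    simp only [OT.refine, Option.map_map]
    congr 1
    funext b
    rw [Function.comp_apply, Action.eval_subst, hσ]
  · simp only [OT.refine, Action.eval_subst, hσ]
  · funext x
    by_cases hx : x ∈ B.vars
    · simp only [Valuation.after, OT.refine, if_pos hx, overlay_of_mem hx, Expr.eval_subst]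
      exact congrArg (Expr.eval · (o.post x)) hσ
    · simp only [Valuation.after, OT.refine, if_neg hx, overlay_of_notMem hx, Expr.eval]

theorem Run.tau_append {s ρ H₁ s₁ ρ₁ H₂ s₂ ρ₂} (h₁ : B.Run s ρ H₁ (groundTau A) s₁ ρ₁)
    {a : GroundAction A} (h₂ : B.Run s₁ ρ₁ H₂ a s₂ ρ₂) :
    B.Run s ρ (fun j => H₁ j ++ H₂ j) a s₂ ρ₂ := by
  simpa using h₁.trans h₂ (Run.refl _ _)

theorem Run.append_tau {s ρ H₁ s₁ ρ₁ H₂ s₂ ρ₂} {a : GroundAction A}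
    (h₁ : B.Run s ρ H₁ a s₁ ρ₁) (h₂ : B.Run s₁ ρ₁ H₂ (groundTau A) s₂ ρ₂) :
    B.Run s ρ (fun j => H₁ j ++ H₂ j) a s₂ ρ₂ := by
  simpa using (Run.refl s ρ).trans h₁ h₂

/-- A run with a visible action consists of a step with this action between silent runs. -/
theorem Run.exists_step {s ρ H a s' ρ'} (hr : B.Run s ρ H a s' ρ') (ha : a ≠ groundTau A) :
    ∃ H₁ s₁ ρ₁ h s₂ ρ₂ H₃, B.Run s ρ H₁ (groundTau A) s₁ ρ₁ ∧ B.Step s₁ ρ₁ h a s₂ ρ₂ ∧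
      B.Run s₂ ρ₂ H₃ (groundTau A) s' ρ' ∧ ∀ j, H j = H₁ j ++ groundVis (h j) ++ H₃ j := by
  induction hr with
  | refl s ρ => exact absurd rfl ha
  | lift hs => exact ⟨_, _, _, _, _, _, _, .refl _ _, hs, .refl _ _, by simp⟩
  -- The visible action belongs to the middle run; the outer runs are silent and are absorbed by the
  -- silent parts.
  | trans h₁ h₂ h₃ _ ih _ =>
    obtain ⟨K₁, s₁, ρ₁, h, s₂, ρ₂, K₃, r₁, hs, r₃, hH⟩ := ih ha
    exact ⟨_, _, _, _, _, _, _, h₁.tau_append r₁, hs, r₃.append_tau h₃, by simp [hH]⟩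

/-- The substitutions by `Post` in a composed weak transition amount to evaluating the later
components under the valuations reached so far. With `Run.exists_weak`, the runs are exactly the
ground instances of weak open transitions. -/
theorem Run.of_weak {x : WOT A Idx B.St} (hx : Weak B.trans x) :
    ∀ ρ, x.pred ρ → B.Run x.src ρ (fun j => (x.hole j).map (Action.eval ρ)) (x.act.eval ρ) x.dst
      (ρ.after x.post) := by
  induction hx with
  | refl s => intro ρ _; exact .refl s ρ
  | lift t ht =>
    intro ρ hρ
    simp only [map_eval_vis]
    exact .lift ⟨t, ht, rfl, rfl, hρ, fun _ => rfl, rfl, rfl⟩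
  | trans w₁ w₂ w₃ _ _ _ ha₁ ha₃ h₁₂ h₂₃ ih₁ ih₂ ih₃ =>
    rintro ρ ⟨hp₁, hp₂, hp₃⟩
    have r₁ := ih₁ ρ hp₁
    have r₂ := ih₂ _ hp₂
    have r₃ := ih₃ _ hp₃
    rw [ha₁, Action.eval_tauAct, h₁₂] at r₁
    rw [h₂₃] at r₂
    rw [ha₃, Action.eval_tauAct, Valuation.after_comp] at r₃
    have r := r₁.trans r₂ r₃
    simp only [List.map_append, List.map_map, Valuation.after_comp, Action.eval_subst,
      Function.comp_def]
    exact r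

theorem Run.exists_weak {s ρ H a s' ρ'} (hr : B.Run s ρ H a s' ρ') :
    ∃ x, Weak B.trans x ∧ x.src = s ∧ x.dst = s' ∧ x.pred ρ ∧
      (∀ j, (x.hole j).map (Action.eval ρ) = H j) ∧ x.act.eval ρ = a ∧ ρ.after x.post = ρ' := by
  induction hr with
  | refl s ρ => exact ⟨_, .refl s, rfl, rfl, trivial, fun _ => rfl, rfl, rfl⟩
  | lift hs =>
    obtain ⟨o, ho, rfl, rfl, hp, hh, rfl, rfl⟩ := hs
    exact ⟨_, .lift o ho, rfl, rfl, hp, fun j => by rw [map_eval_vis, hh], rfl, rfl⟩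
  | trans _ _ _ ih₁ ih₂ ih₃ =>
    obtain ⟨w₁, hw₁, rfl, hd₁, hp₁, hh₁, ha₁, rfl⟩ := ih₁
    obtain ⟨w₂, hw₂, rfl, hd₂, hp₂, hh₂, rfl, rfl⟩ := ih₂
    obtain ⟨w₃, hw₃, rfl, rfl, hp₃, hh₃, ha₃, rfl⟩ := ih₃
    refine ⟨_, .trans w₁ w₂ w₃ hw₁ hw₂ hw₃ (Action.eval_eq_groundTau.1 ha₁)
      (Action.eval_eq_groundTau.1 ha₃) hd₁ hd₂, rfl, rfl, ⟨hp₁, hp₂, ?_⟩, ?_, ?_, ?_⟩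
    · rw [Pred.subst, Valuation.after_comp]; exact hp₃
    · intro j
      simp only [List.map_append, List.map_map, ← hh₁, ← hh₂, ← hh₃, Valuation.after_comp,
        Action.eval_subst, Function.comp_def]
    · exact Action.eval_subst _ _ _
    · simp only [Valuation.after_comp]

end OpenAutomaton

/-! ### Weak simulation, one valuation at a time -/

/-- Weak simulation in terms of ground steps and runs. -/
def GroundSimulates (A₁ A₂ : OpenAutomaton.{u, v, w} A Idx) (R : A₁.St → A₂.St → Pred A) : Prop :=
  ∀ s t ρ h a s₁ ρ₁, R s t ρ → A₁.Step s ρ h a s₁ ρ₁ →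
    ∃ t₁ ρ₂, A₂.Run t ρ (fun j => groundVis (h j)) a t₁ ρ₂ ∧
      R s₁ t₁ (overlay A₁.vars ρ₁ (overlay A₂.vars ρ₂ ρ))

/-- The disjunction over the covering family stands inside the quantifier over valuations, so each
valuation may use its own weak transition. -/
theorem weakSimulates_iff_groundSimulates {A₁ A₂ : OpenAutomaton.{u, v, w} A Idx}
    {R : A₁.St → A₂.St → Pred A} : WeakSimulates A₁ A₂ R ↔ GroundSimulates A₁ A₂ R := by
  have hvis : ∀ b : Option (Action A), (∃ b', b = some b' ∧ b' ≠ tauAct A) ↔ vis b ≠ [] := by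
    intro b
    cases b with
    | none => simp [vis]
    | some b => by_cases hb : b = tauAct A <;> simp [vis, hb]
  constructor
  · rintro H _ t ρ _ _ _ _ hR ⟨o, ho, rfl, rfl, hp, hh, rfl, rfl⟩
    obtain ⟨X, hX, hcov⟩ := H t o ho
    obtain ⟨x, hx, hhole, hxp, hact, hpost⟩ := hcov ρ hR hp
    obtain ⟨hweak, rfl, hdom⟩ := hX x hx
    refine ⟨x.dst, ρ.after x.post, ?_, ?_⟩
    · have r := OpenAutomaton.Run.of_weak hweak ρ hxp
      rw [← hact] at r
      convert r using 2 with j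
      rw [← hh, ← map_eval_vis]
      -- The definition compares hole actions only on the domain of `x`; elsewhere the equality of
      -- domains forces both sides to be empty.
      by_cases hj : x.hole j = []
      · have : ¬ vis (o.hole j) ≠ [] := fun h => by
          have : j ∈ {j | x.hole j ≠ []} := hdom ▸ (hvis _).2 h
          exact this hj
        rw [not_not.1 this, hj]
      · exact hhole j hj
    · rw [Pred.subst, Valuation.after_union] at hpost
      exact hpost
  · intro H t o ho
    -- The largest admissible family: all weak transitions from `t` with the prescribed domain.
    refine ⟨{x | Weak A₂.trans x ∧ x.src = t ∧
      {j | ∃ b, o.hole j = some b ∧ b ≠ tauAct A} = {j | x.hole j ≠ []}}, fun x hx => hx, ?_⟩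
    intro ρ hR hp
    obtain ⟨t₁, ρ₂, r, hR'⟩ := H _ t ρ _ _ _ _ hR ⟨o, ho, rfl, rfl, hp, fun _ => rfl, rfl, rfl⟩
    obtain ⟨x, hx, hsrc, rfl, hxp, hhole, hact, rfl⟩ := r.exists_weak
    simp only [← map_eval_vis] at hhole
    refine ⟨x, ⟨hx, hsrc, ?_⟩, fun j _ => (hhole j).symm, hxp, hact.symm, ?_⟩
    · ext j
      simp only [Set.mem_ofPred_eq, hvis]
      have hnil := congrArg (· = []) (hhole j)
      simp only [List.map_eq_nil_iff, eq_iff_iff] at hnil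
      exact hnil.symm.not
    · rw [Pred.subst, Valuation.after_union]
      exact hR'

/-! ### Ground steps of a node -/

/-- The ground steps of a node for the vector `sv` with its variables evaluated by `η`. -/
structure NodeStep (I J : Set Idx) (D : Idx → PNet.{u, v, w} A Idx) (sv : SyncVec A Idx)
    (η : Valuation A) (s : (i : I) → (D i).State) (ρ : Valuation A)
    (h : Idx → Option (GroundAction A)) (a : GroundAction A) (s' : (i : I) → (D i).State)
    (ρ' : Valuation A) : Prop where
  child : ∀ (i : I) b, sv.comp i = some b →
    (D i).toAutomaton.Step (s i) ρ (overlay (D i).holeIdx h fun _ => none) (b.eval η) (s' i)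
      (overlay (D i).vars ρ' ρ)
  idle : ∀ i : I, sv.comp i = none → s' i = s i
  own_hole : ∀ j ∈ J, h j = (sv.comp j).map (Action.eval η)
  no_hole : ∀ j, j ∉ J → (∀ i : I, sv.comp i ≠ none → j ∉ (D i).holeIdx) → h j = none
  act : a = sv.res.eval η
  guard : sv.guard.Holds η
  post_id : ∀ x, (∀ i : I, sv.comp i ≠ none → x ∉ (D i).vars) → ρ' x = ρ x

theorem Expr.Holds_subst {ρ : Valuation A} {σ : Subst A} {e : Expr A} :
    (e.subst σ).Holds ρ ↔ e.Holds (ρ.after σ) := by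
  rw [Expr.Holds, Expr.eval_subst, Expr.Holds]

namespace PNet

theorem mem_vars_node {I J : Set Idx} {D : Idx → PNet.{u, v, w} A Idx}
    {srt : Idx → Set (ASig A)} {SV : Set (SyncVec A Idx)} {x : A.Var} :
    x ∈ (node I J D srt SV).vars ↔ ∃ i ∈ I, x ∈ (D i).vars := by
  rw [vars]; rfl

theorem mem_holes_node {I J : Set Idx} {D : Idx → PNet.{u, v, w} A Idx}
    {srt : Idx → Set (ASig A)} {SV : Set (SyncVec A Idx)} {p : Idx × Set (ASig A)} :
    p ∈ (node I J D srt SV).holes ↔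
      (p.1 ∈ J ∧ p.2 = srt p.1) ∨ ∃ i ∈ I, p ∈ (D i).holes := by
  rw [holes]; rfl

variable {I J : Set Idx} {D : Idx → PNet.{u, v, w} A Idx}
    {srt : Idx → Set (ASig A)} {SV : Set (SyncVec A Idx)}

theorem nodeStep_of_step {s s' : (i : I) → (D i).State} {ρ ρ' : Valuation A}
    {h : Idx → Option (GroundAction A)} {a : GroundAction A}
    (hs : (node I J D srt SV).toAutomaton.Step s ρ h a s' ρ') :
    ∃ sv ∈ SV, ∃ η, NodeStep I J D sv η s ρ h a s' ρ' := by
  obtain ⟨o, ho, rfl, rfl, hp, hh, rfl, rfl⟩ := hs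
  change o ∈ (node I J D srt SV).trans at ho
  rw [trans] at ho
  obtain ⟨t, ⟨sv, hsv, θ, c, ht⟩, σ, φ, hσ, rfl⟩ := ho
  -- The refining substitution fixes the node's variables, so the sub-pNets see no difference
  -- between `ρ` and `ρ.after σ`.
  have hσV : ∀ x ∈ (node I J D srt SV).vars, ρ x = ρ.after σ x := fun x hx => by
    simp [Valuation.after, hσ x hx, Expr.eval]
  obtain ⟨hp, -⟩ := hp
  rw [Pred.subst, ht.pred_iff] at hp
  obtain ⟨hpc, hca, hha, hact, hg⟩ := hp
  have hhole : ∀ j, h j = (t.hole j).map (Action.eval (ρ.after σ)) := fun j => by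
    rw [← hh]
    simp only [OT.refine, Option.map_map]
    congr 1
    funext b
    exact Action.eval_subst _ _ _
  refine ⟨sv, hsv, (ρ.after σ).after θ, ?_, ?_, ?_, ?_, ?_, ?_, ?_⟩
  · intro i b hb
    have hi : sv.comp i ≠ none := by simp [hb]
    have hstep : (D i).toAutomaton.Step (c i).src (ρ.after σ)
        (fun j => ((c i).hole j).map (Action.eval (ρ.after σ))) ((c i).act.eval (ρ.after σ))
        (c i).dst ((ρ.after σ).after (c i).post) :=
      ⟨c i, ht.child i hi, rfl, rfl, hpc i hi, fun _ => rfl, rfl, rfl⟩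
    have hstep' := hstep.congr (ρ' := ρ) fun x hx => hσV x (mem_vars_node.2 ⟨i, i.2, hx⟩)
    rw [← ht.src_active i hi, ← ht.dst_active i hi, hca i b hb, Action.eval_subst] at hstep'
    have hH : overlay (D i).holeIdx h (fun _ => none) =
        fun j => ((c i).hole j).map (Action.eval (ρ.after σ)) := by
      funext j
      by_cases hj : j ∈ (D i).holeIdx
      · rw [overlay_of_mem hj, hhole, ht.sub_hole i hi j hj]
      · rw [overlay_of_notMem hj, ← hstep.hole_eq_none hj]
    have hV : overlay (D i).vars
        (ρ.after (t.refine (node I J D srt SV).vars σ φ).post) ρ =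
        overlay (D i).vars ((ρ.after σ).after (c i).post) ρ := by
      funext x
      by_cases hx : x ∈ (D i).vars
      · have hxV : x ∈ (node I J D srt SV).vars := mem_vars_node.2 ⟨i, i.2, hx⟩
        rw [overlay_of_mem hx, overlay_of_mem hx]
        simp only [Valuation.after, OT.refine, if_pos hxV, Expr.eval_subst,
          ht.post_active i hi x hx]
      · rw [overlay_of_notMem hx, overlay_of_notMem hx]
    exact (congrArg₂ (fun H ρ₁ => (D i).toAutomaton.Step (t.src i) ρ H
      (b.eval ((ρ.after σ).after θ)) (t.dst i) ρ₁) hH hV).mpr hstep'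
  · exact fun i hi => ht.dst_inactive i hi
  · intro j hj
    rw [hhole]
    cases hb : t.hole j with
    | none =>
      have := (ht.own_hole j hj).not.1 (by simp [hb])
      rw [not_not.1 this]; rfl
    | some b =>
      obtain ⟨a, ha⟩ := Option.ne_none_iff_exists'.1 ((ht.own_hole j hj).1 (by simp [hb]))
      simp only [ha, Option.map_some, hha j hj b a hb ha, Action.eval_subst]
  · intro j hj hc
    rw [hhole, ht.no_hole j hj hc]; rfl
  · simp only [OT.refine, Action.eval_subst, hact]
  · exact Expr.Holds_subst.1 hg
  · intro x hx
    simp only [Valuation.after, OT.refine, ht.post_id x hx]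
    split_ifs with hxV
    · exact (hσV x hxV).symm
    · rfl

/-- Well-formedness makes the variables of the sub-pNets disjoint, and likewise all holes, so the
assignments and hole actions of the sub-pNets assemble into one open transition; the other data are
entered as constants. -/
theorem step_of_nodeStep (hwf : (node I J D srt SV).WF) {s s' : (i : I) → (D i).State}
    {ρ ρ' : Valuation A} {h : Idx → Option (GroundAction A)} {a : GroundAction A}
    {sv : SyncVec A Idx} (hsv : sv ∈ SV) {η : Valuation A}
    (hs : NodeStep I J D sv η s ρ h a s' ρ') :
    (node I J D srt SV).toAutomaton.Step s ρ h a s' ρ' := by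
  classical
  rw [WF] at hwf
  obtain ⟨hIJ, -, -, hvars, hholeJ, hholes, hvec⟩ := hwf
  have hchild : ∀ i : I, ∃ o : OT A Idx (D i).State, ∀ b, sv.comp i = some b →
      o ∈ (D i).trans ∧ o.src = s i ∧ o.dst = s' i ∧ o.pred ρ ∧
      (∀ j, (o.hole j).map (Action.eval ρ) =
        overlay (D i).holeIdx h (fun _ => none) j) ∧ o.act.eval ρ = b.eval η ∧
      ρ.after o.post = overlay (D i).vars ρ' ρ := by
    intro i
    cases hi : sv.comp i with
    -- A sub-pNet outside the vector gets an arbitrary transition, which the node rule never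
    -- consults.
    | none => exact ⟨⟨s i, fun _ => none, fun _ => True, Subst.id, tauAct A, s i⟩, by simp⟩
    | some b =>
      obtain ⟨o, ho⟩ := hs.child i b hi
      exact ⟨o, by rintro _ ⟨⟩; exact ho⟩
  choose c hc using hchild
  have hc' : ∀ i : I, sv.comp i ≠ none → ∃ b, sv.comp i = some b :=
    fun i hi => Option.ne_none_iff_exists'.1 hi
  let actHole (i : I) (j : Idx) : Prop := sv.comp i ≠ none ∧ j ∈ (D i).holeIdx
  let actVar (i : I) (x : A.Var) : Prop := sv.comp i ≠ none ∧ x ∈ (D i).vars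
  -- The vector is instantiated by the constants given by `η`.
  let θ : Subst A := fun x => .val (η x)
  have hθ : ρ.after θ = η := rfl
  let hole : Idx → Option (Action A) := fun j =>
    if j ∈ J then (h j).map GroundAction.toAction
    else if hj : ∃ i, actHole i j then (c hj.choose).hole j else none
  let post : Subst A := fun x => if hx : ∃ i, actVar i x then (c hx.choose).post x else .var x
  have hhole_sub : ∀ i : I, sv.comp i ≠ none → ∀ j ∈ (D i).holeIdx, hole j = (c i).hole j := by
    intro i hi j hj
    have hJ : j ∉ J := (hholeJ i i.2).notMem_of_mem_left hj
    have hex : ∃ i, actHole i j := ⟨i, hi, hj⟩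
    -- Disjointness of the hole sets makes the chosen sub-pNet the right one.
    have heq : hex.choose = i := by
      by_contra hne
      exact (hholes _ hex.choose.2 i i.2 (fun h => hne (Subtype.ext h))).notMem_of_mem_left
        hex.choose_spec.2 hj
    simp only [hole, if_neg hJ, dif_pos hex]
    rw [heq]
  have hpost_sub : ∀ i : I, sv.comp i ≠ none → ∀ x ∈ (D i).vars, post x = (c i).post x := by
    intro i hi x hx
    have hex : ∃ i, actVar i x := ⟨i, hi, hx⟩
    have heq : hex.choose = i := by
      by_contra hne
      exact (hvars _ hex.choose.2 i i.2 (fun h => hne (Subtype.ext h))).notMem_of_mem_left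
        hex.choose_spec.2 hx
    simp only [post, dif_pos hex]
    rw [heq]
  have hpost_id : ∀ x, (∀ i : I, sv.comp i ≠ none → x ∉ (D i).vars) → post x = .var x := by
    intro x hx
    exact dif_neg fun ⟨i, hi, hxi⟩ => hx i hi hxi
  have hno_hole : ∀ j, j ∉ J → (∀ i : I, sv.comp i ≠ none → j ∉ (D i).holeIdx) →
      hole j = none := by
    intro j hj hx
    simp only [hole, if_neg hj]
    exact dif_neg fun ⟨i, hi, hji⟩ => hx i hi hji
  have hmap : ∀ b : Option (GroundAction A),
      (b.map GroundAction.toAction).map (Action.eval ρ) = b := by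
    intro b
    cases b <;> simp [GroundAction.eval_toAction]
  let t : OT A Idx ((i : I) → (D i).State) :=
    { src := s
      hole := hole
      pred := fun ρ => (∀ i : I, sv.comp i ≠ none → (c i).pred ρ) ∧
        (∀ (i : I) a, sv.comp i = some a → (c i).act.eval ρ = (a.subst θ).eval ρ) ∧
        (∀ j ∈ J, ∀ b a, hole j = some b → sv.comp j = some a → b.eval ρ = (a.subst θ).eval ρ) ∧
        a.toAction.eval ρ = (sv.res.subst θ).eval ρ ∧ (sv.guard.subst θ).Holds ρ
      post := post
      act := a.toAction
      dst := s' }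
  have ht : NodeRule J srt (fun i : I => (D i).vars) (fun i => (D i).holeIdx)
      (fun i => (D i).trans) sv θ c t := by
    refine ⟨?_, ?_, ?_, fun i hi => hs.idle i hi, ?_, ?_, hhole_sub, hno_hole, fun _ => Iff.rfl,
      hpost_sub, hpost_id⟩
    · intro i hi
      obtain ⟨b, hb⟩ := hc' i hi
      exact (hc i b hb).1
    · intro i hi
      obtain ⟨b, hb⟩ := hc' i hi
      exact (hc i b hb).2.1.symm
    · intro i hi
      obtain ⟨b, hb⟩ := hc' i hi
      exact (hc i b hb).2.2.1.symm
    · intro j hj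
      simp [t, hole, hj, hs.own_hole j hj]
    · intro j hj b hb
      simp only [t, hole, if_pos hj, hs.own_hole j hj, Option.map_map, Option.map_eq_some_iff] at hb
      obtain ⟨a, ha, rfl⟩ := hb
      rw [Function.comp_apply, Action.sig_toAction_of_eval]
      rcases (hvec sv hsv).1 j a ha with ⟨hI, _⟩ | ⟨_, hsig⟩
      · exact absurd hj (hIJ.notMem_of_mem_left hI)
      · exact hsig
  refine ⟨t.refine (node I J D srt SV).vars Subst.id fun _ => True, ?_, rfl, rfl, ⟨?_, trivial⟩,
    ?_, ?_, ?_⟩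
  · change _ ∈ (node I J D srt SV).trans
    rw [trans]
    exact ⟨t, ⟨sv, hsv, θ, c, ht⟩, Subst.id, _, fun _ _ => rfl, rfl⟩
  · rw [Pred.subst, Valuation.after_id]
    refine ⟨?_, ?_, ?_, ?_, ?_⟩
    · intro i hi
      obtain ⟨b, hb⟩ := hc' i hi
      exact (hc i b hb).2.2.2.1
    · intro i b hb
      rw [Action.eval_subst, hθ]
      exact (hc i b hb).2.2.2.2.2.1
    · intro j hj b a hb ha
      rw [Action.eval_subst, hθ]
      have := congrArg (Option.map (Action.eval ρ)) hb
      simp only [hole, if_pos hj, hs.own_hole j hj, ha, Option.map_some,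
        GroundAction.eval_toAction] at this
      exact (Option.some.inj this).symm
    · rw [Action.eval_subst, hθ, GroundAction.eval_toAction, hs.act]
    · rw [Expr.Holds_subst, hθ]; exact hs.guard
  · intro j
    have hid : ((t.refine (node I J D srt SV).vars Subst.id fun _ => True).hole j).map
        (Action.eval ρ) = (hole j).map (Action.eval ρ) := by
      simp only [OT.refine, Option.map_map, t]
      congr 1
      funext b
      exact Action.eval_subst _ _ _
    refine hid.trans ?_
    by_cases hj : j ∈ J
    · simp only [hole, if_pos hj, hmap]
    · by_cases hex : ∀ i : I, sv.comp i ≠ none → j ∉ (D i).holeIdx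
      · rw [hno_hole j hj hex, hs.no_hole j hj hex]; rfl
      · push Not at hex
        obtain ⟨i, hi, hji⟩ := hex
        obtain ⟨b, hb⟩ := hc' i hi
        rw [hhole_sub i hi j hji, (hc i b hb).2.2.2.2.1 j, overlay_of_mem hji]
  · simp only [OT.refine, Action.eval_subst, Valuation.after_id, t, GroundAction.eval_toAction]
  · funext x
    by_cases hex : ∀ i : I, sv.comp i ≠ none → x ∉ (D i).vars
    · simp only [Valuation.after, OT.refine, t, hpost_id x hex, hs.post_id x hex]
      split_ifs <;> rfl
    · push Not at hex
      obtain ⟨i, hi, hxi⟩ := hex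
      obtain ⟨b, hb⟩ := hc' i hi
      have hxV : x ∈ (node I J D srt SV).vars := mem_vars_node.2 ⟨i, i.2, hxi⟩
      have hpx := congrFun (hc i b hb).2.2.2.2.2.2 x
      rw [overlay_of_mem hxi] at hpx
      simp only [Valuation.after, OT.refine, if_pos hxV, Expr.eval_subst, t,
        hpost_sub i hi x hxi]
      exact hpx

end PNet

/-! ### Gluing functions along disjoint sets -/

theorem overlay_congr {X β : Type*} {V : Set X} {f f' g g' : X → β}
    (hf : ∀ x ∈ V, f x = f' x) (hg : ∀ x, x ∉ V → g x = g' x) :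
    overlay V f g = overlay V f' g' := by
  funext x
  by_cases hx : x ∈ V
  · rw [overlay_of_mem hx, overlay_of_mem hx, hf x hx]
  · rw [overlay_of_notMem hx, overlay_of_notMem hx, hg x hx]

open Classical in
/-- The function that is `g k` on `Z k` and `f` outside all the sets `Z k`. -/
noncomputable def glue {X κ β : Type*} (Z : κ → Set X) (f : X → β) (g : κ → X → β) : X → β :=
  fun x => if h : ∃ k, x ∈ Z k then g h.choose x else f x

theorem glue_of_mem {X κ β : Type*} {Z : κ → Set X} (hZ : ∀ k l, k ≠ l → Disjoint (Z k) (Z l))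
    {f : X → β} {g : κ → X → β} {k : κ} {x : X} (hx : x ∈ Z k) : glue Z f g x = g k x := by
  have h : ∃ k, x ∈ Z k := ⟨k, hx⟩
  have hk : h.choose = k := by
    by_contra hne
    exact (hZ _ _ hne).notMem_of_mem_left h.choose_spec hx
  rw [glue, dif_pos h, hk]

theorem glue_of_notMem {X κ β : Type*} {Z : κ → Set X} {f : X → β} {g : κ → X → β} {x : X}
    (hx : ∀ k, x ∉ Z k) : glue Z f g x = f x :=
  dif_neg fun ⟨k, hk⟩ => hx k hk

theorem glue_congr {X κ β : Type*} {Z : κ → Set X} {f f' : X → β} {g : κ → X → β}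
    (hf : ∀ x, (∀ k, x ∉ Z k) → f x = f' x) : glue Z f g = glue Z f' g := by
  funext x
  by_cases h : ∃ k, x ∈ Z k
  · simp only [glue, dif_pos h]
  · push Not at h
    rw [glue_of_notMem h, glue_of_notMem h, hf x h]

theorem comp_glue {X κ β γ : Type*} (Z : κ → Set X) (f : X → β) (g : κ → X → β) (φ : β → γ)
    (x : X) : φ (glue Z f g x) = glue Z (fun x => φ (f x)) (fun k x => φ (g k x)) x := by
  simp only [glue]
  split_ifs <;> rfl

theorem glue_append {X κ β : Type*} (Z : κ → Set X) (f f' : X → List β) (g g' : κ → X → List β)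
    (x : X) : glue Z f g x ++ glue Z f' g' x =
      glue Z (fun x => f x ++ f' x) (fun k x => g k x ++ g' k x) x := by
  simp only [glue]
  split_ifs <;> rfl

theorem glue_const {X κ β : Type*} (Z : κ → Set X) (b : β) (x : X) :
    glue Z (fun _ => b) (fun _ _ => b) x = b := by
  simp only [glue]
  split_ifs <;> rfl

/-! ### Consecutive runs -/

namespace OpenAutomaton

variable {B : OpenAutomaton.{u, v, w} A Idx}

theorem Run.of_hole_eq {s ρ H a s' ρ' H'} (r : B.Run s ρ H a s' ρ') (h : ∀ j, H' j = H j) :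
    B.Run s ρ H' a s' ρ' := by
  obtain rfl : H' = H := funext h
  exact r

variable (B) in
/-- Consecutive runs with the given actions. -/
def Runs : List (GroundAction A) → B.St → Valuation A → (Idx → List (GroundAction A)) →
    B.St → Valuation A → Prop
  | [], s, ρ, H, s', ρ' => H = (fun _ => []) ∧ s' = s ∧ ρ' = ρ
  | b :: L, s, ρ, H, s', ρ' => ∃ H₁ s₁ ρ₁ H₂, B.Run s ρ H₁ b s₁ ρ₁ ∧ Runs L s₁ ρ₁ H₂ s' ρ' ∧
      H = fun j => H₁ j ++ H₂ j

theorem Runs.split {L L' : List (GroundAction A)} {s ρ H s' ρ'} (r : B.Runs (L ++ L') s ρ H s' ρ') :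
    ∃ H₁ s₁ ρ₁ H₂, B.Runs L s ρ H₁ s₁ ρ₁ ∧ B.Runs L' s₁ ρ₁ H₂ s' ρ' ∧
      H = fun j => H₁ j ++ H₂ j := by
  induction L generalizing s ρ H with
  | nil => exact ⟨_, _, _, _, ⟨rfl, rfl, rfl⟩, r, rfl⟩
  | cons b L ih =>
    obtain ⟨H₁, s₁, ρ₁, H₂, r₁, r₂, rfl⟩ := r
    obtain ⟨H₃, s₂, ρ₂, H₄, r₃, r₄, rfl⟩ := ih r₂
    exact ⟨_, _, _, _, ⟨_, _, _, _, r₁, r₃, rfl⟩, r₄, by simp⟩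

theorem runs_singleton {b : GroundAction A} {s ρ H s' ρ'} :
    B.Runs [b] s ρ H s' ρ' ↔ B.Run s ρ H b s' ρ' := by
  constructor
  · rintro ⟨H₁, s₁, ρ₁, _, r, ⟨rfl, rfl, rfl⟩, rfl⟩
    exact r.of_hole_eq fun j => by simp
  · intro r
    exact ⟨_, _, _, _, r, ⟨rfl, rfl, rfl⟩, by simp⟩

end OpenAutomaton

theorem groundVis_eq_nil {b : Option (GroundAction A)} :
    groundVis b = [] ↔ b = none ∨ b = some (groundTau A) := by
  cases b with
  | none => simp [groundVis]
  | some b => by_cases hb : b = groundTau A <;> simp [groundVis, hb]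

theorem groundVis_of_ne {b : GroundAction A} (hb : b ≠ groundTau A) :
    groundVis (some b) = [b] := if_neg hb

/-! ### States, valuations and hole actions of a filled node -/

open PNet

/-- A node `⟨D i, srt, SV⟩` with holes `J`, and a set `K` of holes that the nets `D k` can fill
such that the result is a pNet. -/
structure Fillable (I J K : Set Idx) (D : Idx → PNet.{u, v, w} A Idx)
    (srt : Idx → Set (ASig A)) (SV : Set (SyncVec A Idx)) : Prop where
  wf : (node I J D srt SV).WF
  wf_fill : (node (I ∪ K) (J \ K) D srt SV).WF
  subset : K ⊆ J
  finite : ∀ sv ∈ SV, {k ∈ K | sv.comp k ≠ none}.Finite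

variable {I J K : Set Idx} {D : Idx → PNet.{u, v, w} A Idx}

open Classical in
/-- The state of the filled node made of a state of the node and states of the nets filling `K`. -/
noncomputable def glueState (s : (i : I) → (D i).State) (q : (k : K) → (D k).State) :
    (i : (I ∪ K : Set Idx)) → (D i).State :=
  fun i => if h : i.1 ∈ K then q ⟨i, h⟩ else s ⟨i, i.2.resolve_right h⟩

theorem glueState_of_mem (s : (i : I) → (D i).State) (q : (k : K) → (D k).State)
    {i : Idx} (hi : i ∈ I ∪ K) (h : i ∈ K) : glueState s q ⟨i, hi⟩ = q ⟨i, h⟩ := dif_pos h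

theorem glueState_of_notMem (s : (i : I) → (D i).State) (q : (k : K) → (D k).State)
    {i : Idx} (hi : i ∈ I ∪ K) (h : i ∉ K) :
    glueState s q ⟨i, hi⟩ = s ⟨i, hi.resolve_right h⟩ := dif_neg h

theorem glueState_restrict (S : (i : (I ∪ K : Set Idx)) → (D i).State) :
    glueState (fun i : I => S ⟨i, .inl i.2⟩) (fun k : K => S ⟨k, .inr k.2⟩) = S := by
  funext i
  by_cases h : i.1 ∈ K
  · exact glueState_of_mem _ _ i.2 h
  · exact glueState_of_notMem _ _ i.2 h

variable (K D) in
/-- The valuation made of one for the node and one for each net filling `K`. -/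
noncomputable def glueVal (ρ : Valuation A) (ρQ : K → Valuation A) : Valuation A :=
  glue (fun k : K => (D k).vars) ρ ρQ

open Classical in
variable (K D) in
/-- The hole actions made of those of the node, without `K`, and of the nets filling `K`. -/
noncomputable def glueHole {β : Type*} (d : β) (h : Idx → β) (hQ : K → Idx → β) : Idx → β :=
  glue (fun k : K => (D k).holeIdx) (fun j => if j ∈ K then d else h j) hQ

theorem groundVis_glueHole (h : Idx → Option (GroundAction A))
    (hQ : K → Idx → Option (GroundAction A)) (j : Idx) :
    groundVis (glueHole K D none h hQ j) =
      glueHole K D [] (fun j => groundVis (h j)) (fun k j => groundVis (hQ k j)) j := by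
  rw [glueHole, comp_glue _ _ _ groundVis, glueHole]
  congr 1
  funext j
  split_ifs <;> rfl

theorem glueHole_append {β : Type*} (h h' : Idx → List β) (hQ hQ' : K → Idx → List β) (j : Idx) :
    glueHole K D [] h hQ j ++ glueHole K D [] h' hQ' j =
      glueHole K D [] (fun j => h j ++ h' j) (fun k j => hQ k j ++ hQ' k j) j := by
  rw [glueHole, glueHole, glue_append, glueHole]
  congr 1
  funext j
  split_ifs <;> rfl

theorem glueHole_nil {β : Type*} (d : β) (j : Idx) :
    glueHole K D d (fun _ => d) (fun _ _ => d) j = d := by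
  simp only [glueHole, ite_self]
  exact glue_const _ _ _

/-! ### Steps and runs of a filled node -/

namespace Fillable

variable {srt : Idx → Set (ASig A)} {SV : Set (SyncVec A Idx)}

theorem disjoint_IJ (F : Fillable I J K D srt SV) : Disjoint I J := by
  have h := F.wf; rw [WF] at h; exact h.1

theorem notMem_of_mem_I (F : Fillable I J K D srt SV) {i : Idx} (hi : i ∈ I) : i ∉ K :=
  fun hk => F.disjoint_IJ.notMem_of_mem_left hi (F.subset hk)

theorem disjoint_vars (F : Fillable I J K D srt SV) {i l : Idx} (hi : i ∈ I ∪ K) (hl : l ∈ I ∪ K)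
    (h : i ≠ l) : Disjoint (D i).vars (D l).vars := by
  have hw := F.wf_fill; rw [WF] at hw; exact hw.2.2.2.1 i hi l hl h

theorem disjoint_holeIdx (F : Fillable I J K D srt SV) {i l : Idx} (hi : i ∈ I ∪ K)
    (hl : l ∈ I ∪ K) (h : i ≠ l) : Disjoint (D i).holeIdx (D l).holeIdx := by
  have hw := F.wf_fill; rw [WF] at hw; exact hw.2.2.2.2.2.1 i hi l hl h

theorem holeIdx_notMem_J (F : Fillable I J K D srt SV) {i j : Idx} (hi : i ∈ I)
    (hj : j ∈ (D i).holeIdx) : j ∉ J := by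
  have hw := F.wf; rw [WF] at hw; exact (hw.2.2.2.2.1 i hi).notMem_of_mem_left hj

theorem holeIdx_notMem_diff (F : Fillable I J K D srt SV) {k j : Idx} (hk : k ∈ K)
    (hj : j ∈ (D k).holeIdx) : j ∉ J \ K := by
  have hw := F.wf_fill; rw [WF] at hw
  exact (hw.2.2.2.2.1 k (.inr hk)).notMem_of_mem_left hj

theorem glueVal_of_mem (F : Fillable I J K D srt SV) {ρ : Valuation A} {ρQ : K → Valuation A}
    (k : K) {x : A.Var} (hx : x ∈ (D k).vars) : glueVal K D ρ ρQ x = ρQ k x :=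
  glue_of_mem (Z := fun k : K => (D k).vars)
    (fun k l hkl => F.disjoint_vars (.inr k.2) (.inr l.2) fun h => hkl (Subtype.ext h)) hx

theorem glueVal_of_mem_I (F : Fillable I J K D srt SV) {ρ : Valuation A} {ρQ : K → Valuation A}
    {i : Idx} (hi : i ∈ I) {x : A.Var} (hx : x ∈ (D i).vars) : glueVal K D ρ ρQ x = ρ x :=
  glue_of_notMem fun k => (F.disjoint_vars (.inl hi) (.inr k.2)
    fun h => F.notMem_of_mem_I hi (h ▸ k.2)).notMem_of_mem_left hx

theorem glueHole_of_mem (F : Fillable I J K D srt SV) {β : Type*} {d : β} {h : Idx → β}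
    {hQ : K → Idx → β} (k : K) {j : Idx} (hj : j ∈ (D k).holeIdx) :
    glueHole K D d h hQ j = hQ k j :=
  glue_of_mem (Z := fun k : K => (D k).holeIdx)
    (fun k l hkl => F.disjoint_holeIdx (.inr k.2) (.inr l.2) fun h => hkl (Subtype.ext h)) hj

theorem _root_.Pnet.glueHole_of_notMem {β : Type*} {d : β} {h : Idx → β} {hQ : K → Idx → β}
    {j : Idx} (hjK : j ∉ K) (hj : ∀ k : K, j ∉ (D k).holeIdx) : glueHole K D d h hQ j = h j :=
  (glue_of_notMem hj).trans (if_neg hjK)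

/-- The second hypothesis is needed: a hole inside a filling net may reuse a name from `K`, since in
the filled node only clashes with `J \ K` and with the other sub-pNets are excluded. -/
theorem _root_.Pnet.glueHole_of_mem_K {β : Type*} {d : β} {h : Idx → β} {hQ : K → Idx → β}
    {j : Idx} (hjK : j ∈ K) (hj : ∀ k : K, j ∉ (D k).holeIdx) : glueHole K D d h hQ j = d :=
  (glue_of_notMem hj).trans (if_pos hjK)

theorem _root_.Pnet.glueHole_congr {β : Type*} {d : β} {h h' : Idx → β} {hQ : K → Idx → β}
    (hh : ∀ j, j ∉ K → h j = h' j) : glueHole K D d h hQ = glueHole K D d h' hQ :=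
  glue_congr fun j _ => by
    split_ifs with hj
    · rfl
    · exact hh j hj

theorem glueHole_of_mem_I (F : Fillable I J K D srt SV) {β : Type*} {d : β} {h : Idx → β}
    {hQ : K → Idx → β} {i : Idx} (hi : i ∈ I) {j : Idx} (hj : j ∈ (D i).holeIdx) :
    glueHole K D d h hQ j = h j :=
  glueHole_of_notMem (fun hjK => F.holeIdx_notMem_J hi hj (F.subset hjK))
    fun k => (F.disjoint_holeIdx (.inl hi) (.inr k.2)
      fun h => F.notMem_of_mem_I hi (h ▸ k.2)).notMem_of_mem_left hj

/-- A step of the node and matching steps of the nets filling `K` make a step of the filled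
node. -/
theorem nodeStep_glue (F : Fillable I J K D srt SV) {sv : SyncVec A Idx}
    {η : Valuation A} {s s₁ : (i : I) → (D i).State} {ρ ρ₁ : Valuation A}
    {h : Idx → Option (GroundAction A)} {a : GroundAction A}
    (hs : NodeStep I J D sv η s ρ h a s₁ ρ₁)
    {q q₁ : (k : K) → (D k).State} {ρQ ρQ₁ : K → Valuation A}
    {hQ : K → Idx → Option (GroundAction A)}
    (hact : ∀ (k : K) b, sv.comp k = some b →
      (D k).toAutomaton.Step (q k) (ρQ k) (hQ k) (b.eval η) (q₁ k) (ρQ₁ k))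
    (hidle : ∀ k : K, sv.comp k = none → q₁ k = q k ∧ ρQ₁ k = ρQ k ∧ hQ k = fun _ => none) :
    NodeStep (I ∪ K) (J \ K) D sv η (glueState s q) (glueVal K D ρ ρQ) (glueHole K D none h hQ) a
      (glueState s₁ q₁) (glueVal K D ρ₁ ρQ₁) := by
  refine ⟨?_, ?_, ?_, ?_, hs.act, hs.guard, ?_⟩
  · rintro ⟨i, hi⟩ b hb
    by_cases hk : i ∈ K
    · have st := hact ⟨i, hk⟩ b hb
      rw [glueState_of_mem _ _ hi hk, glueState_of_mem _ _ hi hk]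
      have st' := st.congr (ρ' := glueVal K D ρ ρQ) fun x hx => F.glueVal_of_mem ⟨i, hk⟩ hx
      -- A step of `D i` uses only holes of `D i`, so cutting off the other holes loses nothing.
      have hH : overlay (D i).holeIdx (glueHole K D none h hQ) (fun _ => none) = hQ ⟨i, hk⟩ := by
        funext j
        by_cases hj : j ∈ (D i).holeIdx
        · rw [overlay_of_mem hj, F.glueHole_of_mem ⟨i, hk⟩ hj]
        · rw [overlay_of_notMem hj, st.hole_eq_none hj]
      have hV : overlay (D i).vars (glueVal K D ρ₁ ρQ₁) (glueVal K D ρ ρQ) =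
          overlay (D i).vars (ρQ₁ ⟨i, hk⟩) (glueVal K D ρ ρQ) :=
        overlay_congr (fun x hx => F.glueVal_of_mem ⟨i, hk⟩ hx) fun _ _ => rfl
      rw [hH, hV]
      exact st'
    · have hiI : i ∈ I := hi.resolve_right hk
      have st := hs.child ⟨i, hiI⟩ b hb
      rw [glueState_of_notMem _ _ hi hk, glueState_of_notMem _ _ hi hk]
      have st' := st.congr (ρ' := glueVal K D ρ ρQ) fun x hx => F.glueVal_of_mem_I hiI hx
      have hH : overlay (D i).holeIdx (glueHole K D none h hQ) (fun _ => none) =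
          overlay (D i).holeIdx h fun _ => none :=
        overlay_congr (fun j hj => F.glueHole_of_mem_I hiI hj) fun _ _ => rfl
      have hV : overlay (D i).vars (glueVal K D ρ₁ ρQ₁) (glueVal K D ρ ρQ) =
          overlay (D i).vars (overlay (D i).vars ρ₁ ρ) (glueVal K D ρ ρQ) :=
        overlay_congr (fun x hx => (F.glueVal_of_mem_I hiI hx).trans (overlay_of_mem hx).symm)
          fun _ _ => rfl
      rw [hH, hV]
      exact st'
  · rintro ⟨i, hi⟩ hb
    by_cases hk : i ∈ K
    · rw [glueState_of_mem _ _ hi hk, glueState_of_mem _ _ hi hk, (hidle ⟨i, hk⟩ hb).1]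
    · rw [glueState_of_notMem _ _ hi hk, glueState_of_notMem _ _ hi hk]
      exact hs.idle ⟨i, hi.resolve_right hk⟩ hb
  · intro j hj
    rw [glueHole_of_notMem hj.2 fun k hk => F.holeIdx_notMem_diff k.2 hk hj]
    exact hs.own_hole j hj.1
  · intro j hj hno
    by_cases hex : ∃ k : K, j ∈ (D k).holeIdx
    · obtain ⟨k, hk⟩ := hex
      rw [F.glueHole_of_mem k hk]
      have hc : sv.comp k = none := by
        by_contra hc
        exact hno ⟨k, .inr k.2⟩ hc hk
      rw [(hidle k hc).2.2]
    · push Not at hex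
      by_cases hjK : j ∈ K
      · rw [glueHole_of_mem_K hjK hex]
      · rw [glueHole_of_notMem hjK hex]
        exact hs.no_hole j (fun hJ => hj ⟨hJ, hjK⟩) fun i hi => hno ⟨i, .inl i.2⟩ hi
  · intro x hx
    by_cases hex : ∃ k : K, x ∈ (D k).vars
    · obtain ⟨k, hk⟩ := hex
      rw [F.glueVal_of_mem k hk, F.glueVal_of_mem k hk]
      have hc : sv.comp k = none := by
        by_contra hc
        exact hx ⟨k, .inr k.2⟩ hc hk
      rw [(hidle k hc).2.1]
    · push Not at hex
      rw [glueVal, glueVal, glue_of_notMem hex, glue_of_notMem hex]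
      exact hs.post_id x fun i hi => hx ⟨i, .inl i.2⟩ hi

open Classical in
/-- The step of the node underlying a step of the filled node. -/
theorem nodeStep_restrict (F : Fillable I J K D srt SV) {sv : SyncVec A Idx}
    {η : Valuation A} {S S₁ : (i : (I ∪ K : Set Idx)) → (D i).State} {ρ ρ₁ : Valuation A}
    {h : Idx → Option (GroundAction A)} {a : GroundAction A}
    (hs : NodeStep (I ∪ K) (J \ K) D sv η S ρ h a S₁ ρ₁) :
    NodeStep I J D sv η (fun i => S ⟨i, .inl i.2⟩) ρ
      (fun j => if j ∈ K then (sv.comp j).map (Action.eval η)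
        else if ∃ k : K, j ∈ (D k).holeIdx then none else h j) a
      (fun i => S₁ ⟨i, .inl i.2⟩) (overlay (node I J D srt SV).vars ρ₁ ρ) := by
  -- Holes in `K` do what the vector prescribes, while holes inside the filling nets are emptied and
  -- the variables of these nets keep their values, as neither belong to the node.
  refine ⟨?_, ?_, ?_, ?_, hs.act, hs.guard, ?_⟩
  · intro i b hb
    have hH : overlay (D i).holeIdx (fun j => if j ∈ K then (sv.comp j).map (Action.eval η)
        else if ∃ k : K, j ∈ (D k).holeIdx then none else h j) (fun _ => none) =
        overlay (D i).holeIdx h fun _ => none := by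
      refine overlay_congr (fun j hj => ?_) fun _ _ => rfl
      rw [if_neg fun hjK => F.holeIdx_notMem_J i.2 hj (F.subset hjK), if_neg]
      rintro ⟨k, hk⟩
      exact (F.disjoint_holeIdx (.inl i.2) (.inr k.2)
        fun h => F.notMem_of_mem_I i.2 (h ▸ k.2)).notMem_of_mem_left hj hk
    have hV : overlay (D i).vars (overlay (node I J D srt SV).vars ρ₁ ρ) ρ =
        overlay (D i).vars ρ₁ ρ :=
      overlay_congr (fun x hx => overlay_of_mem (mem_vars_node.2 ⟨i, i.2, hx⟩)) fun _ _ => rfl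
    rw [hH, hV]
    exact hs.child ⟨i, .inl i.2⟩ b hb
  · exact fun i hi => hs.idle ⟨i, .inl i.2⟩ hi
  · intro j hj
    by_cases hjK : j ∈ K
    · rw [if_pos hjK]
    · rw [if_neg hjK, if_neg fun ⟨k, hk⟩ => F.holeIdx_notMem_diff k.2 hk ⟨hj, hjK⟩]
      exact hs.own_hole j ⟨hj, hjK⟩
  · intro j hj hno
    rw [if_neg fun hjK => hj (F.subset hjK)]
    split_ifs with hex
    · rfl
    · refine hs.no_hole j (fun h => hj h.1) ?_
      rintro ⟨i, hi | hi⟩ hc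
      · exact hno ⟨i, hi⟩ hc
      · exact fun hji => hex ⟨⟨i, hi⟩, hji⟩
  · intro x hx
    by_cases hxV : x ∈ (node I J D srt SV).vars
    · rw [overlay_of_mem hxV]
      obtain ⟨l, hl, hxl⟩ := mem_vars_node.1 hxV
      refine hs.post_id x ?_
      rintro ⟨i, hi | hi⟩ hc
      · exact hx ⟨i, hi⟩ hc
      · exact fun hxi => (F.disjoint_vars (.inl hl) (.inr hi)
          fun h => F.notMem_of_mem_I hl (h ▸ hi)).notMem_of_mem_left hxl hxi
    · exact overlay_of_notMem hxV

open Classical in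
/-- A silent step of a net filling a hole is a silent step of the filled node. -/
theorem step_of_silent_step (F : Fillable I J K D srt SV)
    (hobs : (node I J D srt SV).CannotObserveSilent) (s : (i : I) → (D i).State) (ρ : Valuation A)
    (q : (l : K) → (D l).State) (ρQ : K → Valuation A) (k : K) {h : Idx → Option (GroundAction A)}
    {q' : (D k).State} {ρ' : Valuation A}
    (st : (D k).toAutomaton.Step (q k) (ρQ k) h (groundTau A) q' ρ') :
    (node (I ∪ K) (J \ K) D srt SV).toAutomaton.Step (glueState s q) (glueVal K D ρ ρQ)
      (glueHole K D none (fun _ => none) (Function.update (fun _ _ => none) k h)) (groundTau A)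
      (glueState s (Function.update q k q')) (glueVal K D ρ (Function.update ρQ k ρ')) := by
  obtain ⟨sv, hsv, hk, hne, hres, hg⟩ := hobs.1 k (.inr (F.subset k.2))
  have hI : ∀ i : I, sv.comp i = none := fun i => hne i fun h => F.notMem_of_mem_I i.2 (h ▸ k.2)
  -- In the unfilled node the vector `(k ↦ τ) → τ` moves nothing; only hole `k` acts.
  have hns : NodeStep I J D sv ρ s ρ (fun j => if j = k then some (groundTau A) else none)
      (groundTau A) s ρ := by
    refine ⟨?_, fun _ _ => rfl, ?_, ?_, ?_, hg ρ, fun _ _ => rfl⟩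
    · intro i b hb
      simp [hI i] at hb
    · intro j _
      split_ifs with hj
      · rw [hj, hk]; rfl
      · rw [hne j hj]; rfl
    · intro j hj _
      exact if_neg fun h : j = k => hj (h ▸ F.subset k.2)
    · rw [hres]; rfl
  refine step_of_nodeStep F.wf_fill hsv (η := ρ) ?_
  have hcongr : ∀ j, j ∉ K → (if j = k then some (groundTau A) else none) = none :=
    fun j hj => if_neg fun h : j = k => hj (h ▸ k.2)
  rw [← glueHole_congr hcongr]
  refine F.nodeStep_glue hns ?_ ?_
  · intro l b hb
    by_cases hl : l = k
    · subst hl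
      rw [hk] at hb
      obtain rfl := Option.some.inj hb
      simp only [Function.update_self]
      exact st
    · rw [hne l fun h => hl (Subtype.ext h)] at hb
      cases hb
  · intro l hl
    have hlk : l ≠ k := by
      rintro rfl
      simp [hk] at hl
    simp [Function.update_of_ne hlk]

open Classical in
/-- A silent run of a net filling a hole is a silent run of the filled node. -/
theorem run_of_silent_run (F : Fillable I J K D srt SV)
    (hobs : (node I J D srt SV).CannotObserveSilent) (s : (i : I) → (D i).State) (ρ : Valuation A)
    (k : K) {q₀ q' : (D k).toAutomaton.St} {ρ₀ ρ' : Valuation A} {H : Idx → List (GroundAction A)}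
    {a : GroundAction A} (r : (D k).toAutomaton.Run q₀ ρ₀ H a q' ρ') (ha : a = groundTau A) :
    ∀ (q : (l : K) → (D l).State) (ρQ : K → Valuation A), q k = q₀ → ρQ k = ρ₀ →
    (node (I ∪ K) (J \ K) D srt SV).toAutomaton.Run (glueState s q) (glueVal K D ρ ρQ)
      (glueHole K D [] (fun _ => []) (Function.update (fun _ _ => []) k H)) (groundTau A)
      (glueState s (Function.update q k q')) (glueVal K D ρ (Function.update ρQ k ρ')) := by
  -- The states of the other nets stay arbitrary, since the composition case restarts from the
  -- updated tuple.
  induction r with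
  | refl q₀ ρ₀ =>
    rintro q ρQ rfl rfl
    rw [Function.update_eq_self, Function.update_eq_self, Function.update_eq_self]
    refine (OpenAutomaton.Run.refl _ _).of_hole_eq fun j => ?_
    exact glueHole_nil _ _
  | lift st =>
    rintro q ρQ rfl rfl
    subst ha
    refine (OpenAutomaton.Run.lift (F.step_of_silent_step hobs s ρ q ρQ k st)).of_hole_eq
      fun j => ?_
    rw [groundVis_glueHole]
    congr 1
    funext l
    by_cases hl : l = k
    · subst hl; simp
    · simp [Function.update_of_ne hl, groundVis]
  | @trans _ _ H₁ q₁ ρ₁ H₂ _ q₂ ρ₂ H₃ _ _ _ _ _ ih₁ ih₂ ih₃ =>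
    intro q ρQ hq hρ
    have r₁ := ih₁ rfl q ρQ hq hρ
    have e : ∀ x y : (D k).State, glueState s (Function.update (Function.update q k x) k y) =
        glueState s (Function.update q k y) :=
      fun x y => by rw [Function.update_idem]
    have e' : ∀ x y : Valuation A,
        glueVal K D ρ (Function.update (Function.update ρQ k x) k y) =
        glueVal K D ρ (Function.update ρQ k y) :=
      fun x y => by rw [Function.update_idem]
    have r₂ := (congrArg₂ ((node (I ∪ K) (J \ K) D srt SV).toAutomaton.Run _ _ _ _)
      (e q₁ q₂) (e' ρ₁ ρ₂)).mp (ih₂ ha (Function.update q k q₁) (Function.update ρQ k ρ₁)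
        (Function.update_self k _ q) (Function.update_self k _ ρQ))
    have r₃ := (congrArg₂ ((node (I ∪ K) (J \ K) D srt SV).toAutomaton.Run _ _ _ _)
      (e q₂ _) (e' ρ₂ _)).mp (ih₃ rfl (Function.update q k q₂) (Function.update ρQ k ρ₂)
        (Function.update_self k _ q) (Function.update_self k _ ρQ))
    refine (r₁.trans r₂ r₃).of_hole_eq fun j => ?_
    rw [glueHole_append, glueHole_append]
    congr 1
    funext l
    by_cases hl : l = k
    · subst hl; simp
    · simp [Function.update_of_ne hl]

open Classical in
/-- Silent runs of finitely many of the nets filling `K` make a silent run of the filled node. -/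
theorem run_of_silent_runs (F : Fillable I J K D srt SV)
    (hobs : (node I J D srt SV).CannotObserveSilent) (s : (i : I) → (D i).State) (ρ : Valuation A)
    (q : (l : K) → (D l).State) (ρQ : K → Valuation A) (T : Finset K) :
    ∀ (q' : (l : K) → (D l).State) (ρQ' : K → Valuation A) (G : K → Idx → List (GroundAction A)),
    (∀ k ∈ T, (D k).toAutomaton.Run (q k) (ρQ k) (G k) (groundTau A) (q' k) (ρQ' k)) →
    (∀ k, k ∉ T → q' k = q k ∧ ρQ' k = ρQ k ∧ G k = fun _ => []) →
    (node (I ∪ K) (J \ K) D srt SV).toAutomaton.Run (glueState s q) (glueVal K D ρ ρQ)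
      (glueHole K D [] (fun _ => []) G) (groundTau A) (glueState s q') (glueVal K D ρ ρQ') := by
  induction T using Finset.induction_on with
  | empty =>
    intro q' ρQ' G _ h
    obtain rfl : q' = q := funext fun k => (h k (by simp)).1
    obtain rfl : ρQ' = ρQ := funext fun k => (h k (by simp)).2.1
    obtain rfl : G = fun _ _ => [] := funext fun k => (h k (by simp)).2.2
    exact (OpenAutomaton.Run.refl _ _).of_hole_eq fun j => glueHole_nil _ _
  | insert k T hkT ih =>
    intro q' ρQ' G hr hid
    -- Let the nets in `T` move while `k` waits at `q k`; then `k` moves alone.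
    have r₁ := ih (Function.update q' k (q k)) (Function.update ρQ' k (ρQ k))
      (Function.update G k fun _ => []) (fun l hl => by
        have hlk : l ≠ k := fun h => hkT (h ▸ hl)
        simp only [Function.update_of_ne hlk]
        exact hr l (Finset.mem_insert_of_mem hl)) (fun l hl => by
        by_cases hlk : l = k
        · subst hlk; simp
        · simp only [Function.update_of_ne hlk]
          exact hid l (by simp [hlk, hl]))
    have r₂ := F.run_of_silent_run hobs s ρ k (hr k (Finset.mem_insert_self _ _)) rfl
      (Function.update q' k (q k)) (Function.update ρQ' k (ρQ k)) (by simp) (by simp)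
    simp only [Function.update_idem, Function.update_eq_self] at r₂
    refine (r₁.tau_append r₂).of_hole_eq fun j => ?_
    rw [glueHole_append]
    congr 1
    funext l
    by_cases hl : l = k
    · subst hl; simp
    · simp [Function.update_of_ne hl]

/-- A step of the node, together with runs of the nets filling `K` for its visible actions in `K`,
makes a run of the filled node. -/
theorem run_of_nodeStep (F : Fillable I J K D srt SV)
    (hobs : (node I J D srt SV).CannotObserveSilent) {sv : SyncVec A Idx} (hsv : sv ∈ SV)
    {η : Valuation A} {s s₁ : (i : I) → (D i).State} {ρ ρ₁ : Valuation A}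
    {h : Idx → Option (GroundAction A)} {a : GroundAction A}
    (hs : NodeStep I J D sv η s ρ h a s₁ ρ₁)
    {q q₁ : (k : K) → (D k).State} {ρQ ρQ₁ : K → Valuation A}
    {G : K → Idx → List (GroundAction A)}
    (hr : ∀ k : K, (D k).toAutomaton.Runs (groundVis (h k)) (q k) (ρQ k) (G k) (q₁ k) (ρQ₁ k)) :
    (node (I ∪ K) (J \ K) D srt SV).toAutomaton.Run (glueState s q) (glueVal K D ρ ρQ)
      (glueHole K D [] (fun j => groundVis (h j)) G) a (glueState s₁ q₁)
      (glueVal K D ρ₁ ρQ₁) := by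
  classical
  have hidle : ∀ k : K, groundVis (h k) = [] →
      q₁ k = q k ∧ ρQ₁ k = ρQ k ∧ G k = fun _ => [] := by
    intro k hk
    have := hr k
    rw [hk] at this
    exact ⟨this.2.1, this.2.2, this.1⟩
  have hh : ∀ k : K, h k = (sv.comp k).map (Action.eval η) :=
    fun k => hs.own_hole k (F.subset k.2)
  -- If a hole of `K` does `τ`, the vector involves nothing else and results in `τ`. The step is
  -- invisible and moves nothing, so the empty run replaces it.
  by_cases htau : ∃ k : K, sv.comp k = some (tauAct A)
  · obtain ⟨k, hk⟩ := htau
    obtain ⟨hres, honly⟩ := hobs.2 sv hsv k (F.subset k.2) hk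
    have hne : ∀ l : Idx, l ≠ k → sv.comp l = none := fun l hl => by
      by_contra hc
      exact hl (honly l hc)
    have hI : ∀ i : I, sv.comp i = none :=
      fun i => hne i fun h => F.notMem_of_mem_I i.2 (h ▸ k.2)
    have hvis : ∀ j, groundVis (h j) = [] := by
      intro j
      by_cases hj : j ∈ J
      · rw [hs.own_hole j hj]
        by_cases hjk : j = k
        · rw [hjk, hk]; simp [groundVis, Action.eval_tauAct]
        · rw [hne j hjk]; rfl
      · rw [hs.no_hole j hj fun i hi => absurd (hI i) hi]; rfl
    obtain rfl : q₁ = q := funext fun l => (hidle l (hvis l)).1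
    obtain rfl : ρQ₁ = ρQ := funext fun l => (hidle l (hvis l)).2.1
    obtain rfl : G = fun _ _ => [] := funext fun l => (hidle l (hvis l)).2.2
    obtain rfl : s₁ = s := funext fun i => hs.idle i (hI i)
    obtain rfl : ρ₁ = ρ := funext fun x => hs.post_id x fun i hi => absurd (hI i) hi
    rw [hs.act, hres, Action.eval_tauAct]
    refine (OpenAutomaton.Run.refl _ _).of_hole_eq fun j => ?_
    simp only [hvis]
    exact glueHole_nil _ _
  · push Not at htau
    have hvis : ∀ (k : K) b, sv.comp k = some b → groundVis (h k) = [b.eval η] ∧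
        b.eval η ≠ groundTau A := by
      intro k b hb
      have hbt : b.eval η ≠ groundTau A := fun h => htau k (by
        rw [hb, Action.eval_eq_groundTau.1 h])
      rw [hh, hb, Option.map_some, groundVis_of_ne hbt]
      exact ⟨rfl, hbt⟩
    have hvis' : ∀ k : K, sv.comp k = none → groundVis (h k) = [] := by
      intro k hk
      rw [hh, hk]; rfl
    -- Each involved net contributes a silent run, a step with the prescribed action and a silent
    -- run; idle nets get trivial pieces so that the choice is uniform.
    have hsplit : ∀ k : K, ∃ H₁ qa ρa hk qb ρb H₃,
        (∀ j, G k j = H₁ j ++ groundVis (hk j) ++ H₃ j) ∧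
        (∀ b, sv.comp k = some b →
          (D k).toAutomaton.Run (q k) (ρQ k) H₁ (groundTau A) qa ρa ∧
          (D k).toAutomaton.Step qa ρa hk (b.eval η) qb ρb ∧
          (D k).toAutomaton.Run qb ρb H₃ (groundTau A) (q₁ k) (ρQ₁ k)) ∧
        (sv.comp k = none → (qa = q k ∧ ρa = ρQ k ∧ H₁ = fun _ => []) ∧
          (qb = qa ∧ ρb = ρa ∧ hk = fun _ => none) ∧
          (q₁ k = qb ∧ ρQ₁ k = ρb ∧ H₃ = fun _ => [])) := by
      intro k
      cases hk : sv.comp k with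
      | none =>
        obtain ⟨h₁, h₂, h₃⟩ := hidle k (hvis' k hk)
        exact ⟨fun _ => [], q k, ρQ k, fun _ => none, q k, ρQ k, fun _ => [],
          fun j => by simp [h₃, groundVis], fun _ hb => (Option.some_ne_none _ hb.symm).elim,
          fun _ => ⟨⟨rfl, rfl, rfl⟩, ⟨rfl, rfl, rfl⟩, h₁, h₂, rfl⟩⟩
      | some b =>
        obtain ⟨hv, hne⟩ := hvis k b hk
        have := hr k
        rw [hv] at this
        obtain ⟨H₁, qa, ρa, hQ, qb, ρb, H₃, r₁, st, r₃, hG⟩ :=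
          (OpenAutomaton.runs_singleton.1 this).exists_step hne
        exact ⟨H₁, qa, ρa, hQ, qb, ρb, H₃, hG, by rintro _ ⟨⟩; exact ⟨r₁, st, r₃⟩,
          fun h => by cases h⟩
    choose H₁ qa ρa hQ qb ρb H₃ hG hact hnone using hsplit
    -- Silent runs of different nets are executed one after another, which requires that finitely
    -- many nets be involved.
    have hTfin : {k : K | sv.comp k ≠ none}.Finite := by
      refine Set.Finite.of_finite_image ((F.finite sv hsv).subset ?_)
        (f := Subtype.val) Subtype.val_injective.injOn
      rintro _ ⟨k, hk, rfl⟩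
      exact ⟨k.2, hk⟩
    have hT : ∀ k, k ∈ hTfin.toFinset ↔ sv.comp k ≠ none := fun k => by simp
    have hsome : ∀ k ∈ hTfin.toFinset, ∃ b, sv.comp k = some b :=
      fun k hk => Option.ne_none_iff_exists'.1 ((hT k).1 hk)
    have hnone' : ∀ k, k ∉ hTfin.toFinset → sv.comp k = none :=
      fun k hk => not_not.1 ((hT k).not.1 hk)
    have r₁ := F.run_of_silent_runs hobs s ρ q ρQ hTfin.toFinset qa ρa H₁
      (fun k hk => by obtain ⟨b, hb⟩ := hsome k hk; exact (hact k b hb).1)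
      (fun k hk => (hnone k (hnone' k hk)).1)
    have r₂ := OpenAutomaton.Run.lift (step_of_nodeStep F.wf_fill hsv
      (F.nodeStep_glue hs (q := qa) (q₁ := qb) (ρQ := ρa) (ρQ₁ := ρb) (hQ := hQ)
        (fun k b hb => (hact k b hb).2.1) (fun k hk => (hnone k hk).2.1)))
    have r₃ := F.run_of_silent_runs hobs s₁ ρ₁ qb ρb hTfin.toFinset q₁ ρQ₁ H₃
      (fun k hk => by obtain ⟨b, hb⟩ := hsome k hk; exact (hact k b hb).2.2)
      (fun k hk => (hnone k (hnone' k hk)).2.2)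
    refine (r₁.trans r₂ r₃).of_hole_eq fun j => ?_
    rw [groundVis_glueHole, glueHole_append, glueHole_append]
    simp only [List.nil_append, List.append_nil]
    congr 1
    funext k j
    exact hG k j

/-- A run of the node, together with runs of the nets filling `K` for its visible actions in `K`,
makes a run of the filled node. -/
theorem run_of_run (F : Fillable I J K D srt SV)
    (hobs : (node I J D srt SV).CannotObserveSilent) {s s₁ : (node I J D srt SV).toAutomaton.St}
    {ρ ρ₁ : Valuation A} {H : Idx → List (GroundAction A)} {a : GroundAction A}
    (r : (node I J D srt SV).toAutomaton.Run s ρ H a s₁ ρ₁) :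
    ∀ {q q₁ : (k : K) → (D k).State} {ρQ ρQ₁ : K → Valuation A}
    {G : K → Idx → List (GroundAction A)},
    (∀ k : K, (D k).toAutomaton.Runs (H k) (q k) (ρQ k) (G k) (q₁ k) (ρQ₁ k)) →
    (node (I ∪ K) (J \ K) D srt SV).toAutomaton.Run (glueState s q) (glueVal K D ρ ρQ)
      (glueHole K D [] H G) a (glueState s₁ q₁) (glueVal K D ρ₁ ρQ₁) := by
  induction r with
  | refl s ρ =>
    intro q q₁ ρQ ρQ₁ G hr
    obtain rfl : q₁ = q := funext fun k => (hr k).2.1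
    obtain rfl : ρQ₁ = ρQ := funext fun k => (hr k).2.2
    obtain rfl : G = fun _ _ => [] := funext fun k => (hr k).1
    exact (OpenAutomaton.Run.refl _ _).of_hole_eq fun j => glueHole_nil _ _
  | lift st =>
    intro q q₁ ρQ ρQ₁ G hr
    obtain ⟨sv, hsv, η, hs⟩ := nodeStep_of_step st
    exact F.run_of_nodeStep hobs hsv hs hr
  | trans _ _ _ ih₁ ih₂ ih₃ =>
    intro q q₁ ρQ ρQ₁ G hr
    -- The runs of every net are cut where the hole sequences of the three parts meet.
    choose G₁₂ qb ρb G₃ h₁₂ h₃ hG using fun k => (hr k).split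
    choose G₁ qa ρa G₂ h₁ h₂ hG' using fun k => (h₁₂ k).split
    refine ((ih₁ h₁).trans (ih₂ h₂) (ih₃ h₃)).of_hole_eq fun j => ?_
    rw [glueHole_append, glueHole_append]
    congr 1
    funext k j
    rw [hG, hG']

end Fillable

/-! ### Filling holes of weakly simulating nodes -/

section Fill

variable {I J I' J' K : Set Idx} {D D' : Idx → PNet.{u, v, w} A Idx}
  {srt srt' : Idx → Set (ASig A)} {SV SV' : Set (SyncVec A Idx)}

theorem glueState_comp_inl (F : Fillable I J K D srt SV) (s : (i : I) → (D i).State)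
    (q : (k : K) → (D k).State) :
    (fun i : I => glueState s q ⟨i, .inl i.2⟩) = s :=
  funext fun i => glueState_of_notMem s q (.inl i.2) (F.notMem_of_mem_I i.2)

theorem glueState_comp_inr (s : (i : I) → (D i).State) (q : (k : K) → (D k).State) (k : K) :
    glueState s q ⟨k, .inr k.2⟩ = q k :=
  glueState_of_mem s q (.inr k.2) k.2

theorem vars_sub_subset_fill {i : Idx} (hi : i ∈ I ∪ K) :
    (D i).vars ⊆ (node (I ∪ K) (J \ K) D srt SV).vars :=
  fun _ hx => mem_vars_node.2 ⟨i, hi, hx⟩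

variable (I I' K) in
/-- The relation between filled nodes made of one between the nodes and one for each pair of nets
filling `K`. -/
def fillRel (RP : ((i : I) → (D i).State) → ((i : I') → (D' i).State) → Pred A)
    (RQ : (k : K) → (D k).State → (D' k).State → Pred A)
    (S : (i : (I ∪ K : Set Idx)) → (D i).State) (S' : (i : (I' ∪ K : Set Idx)) → (D' i).State) :
    Pred A :=
  fun ρ => RP (fun i => S ⟨i, .inl i.2⟩) (fun i => S' ⟨i, .inl i.2⟩) ρ ∧
    ∀ k : K, RQ k (S ⟨k, .inr k.2⟩) (S' ⟨k, .inr k.2⟩) ρ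

/-- The step of the filled node is split, its parts are answered separately from the same valuation
`ρ`, and the answers are merged by `run_of_silent_runs` and `run_of_run`. Each relation depends only
on its own variables, so it survives the passage to the glued valuation. -/
theorem groundSimulates_fill (F : Fillable I J K D srt SV) (F' : Fillable I' J' K D' srt' SV')
    (hobs' : (node I' J' D' srt' SV').CannotObserveSilent)
    (hdisj : Disjoint (node (I ∪ K) (J \ K) D srt SV).vars
      (node (I' ∪ K) (J' \ K) D' srt' SV').vars)
    (hholes : ∀ k : K, (D k).holeIdx = (D' k).holeIdx)
    {RP : ((i : I) → (D i).State) → ((i : I') → (D' i).State) → Pred A}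
    (hRP : ∀ s t (ρ ρ' : Valuation A),
      (∀ x ∈ (node I J D srt SV).vars ∪ (node I' J' D' srt' SV').vars, ρ x = ρ' x) →
      (RP s t ρ ↔ RP s t ρ'))
    (simP : GroundSimulates (node I J D srt SV).toAutomaton
      (node I' J' D' srt' SV').toAutomaton RP)
    {RQ : (k : K) → (D k).State → (D' k).State → Pred A}
    (hRQ : ∀ (k : K) s t (ρ ρ' : Valuation A), (∀ x ∈ (D k).vars ∪ (D' k).vars, ρ x = ρ' x) →
      (RQ k s t ρ ↔ RQ k s t ρ'))
    (simQ : ∀ k : K, GroundSimulates (D k).toAutomaton (D' k).toAutomaton (RQ k)) :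
    GroundSimulates (node (I ∪ K) (J \ K) D srt SV).toAutomaton
      (node (I' ∪ K) (J' \ K) D' srt' SV').toAutomaton (fillRel I I' K RP RQ) := by
  classical
  rintro S S' ρ h a S₁ ρ₁ ⟨hR, hRk⟩ st
  obtain ⟨sv, hsv, η, hs⟩ := nodeStep_of_step st
  obtain ⟨t₁, ρ₂, r, hR₁⟩ := simP _ _ ρ _ _ _ _ hR
    (step_of_nodeStep F.wf hsv (F.nodeStep_restrict hs))
  have hnone : ∀ k : K, sv.comp k = none → ∀ i : (I ∪ K : Set Idx), sv.comp i ≠ none →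
      (i : Idx) ≠ k := fun k hk i hi hik => hi (hik ▸ hk)
  have hsub : ∀ k : K, ∃ (q₁ : (D' k).State) (ρk : Valuation A)
      (G : Idx → List (GroundAction A)),
      (∀ b, sv.comp k = some b →
        (D' k).toAutomaton.Run (S' ⟨k, .inr k.2⟩) ρ G (b.eval η) q₁ ρk) ∧
      (sv.comp k = none → q₁ = S' ⟨k, .inr k.2⟩ ∧ ρk = ρ ∧ G = fun _ => []) ∧
      (∀ j ∈ (D k).holeIdx, G j = groundVis (h j)) ∧
      RQ k (S₁ ⟨k, .inr k.2⟩) q₁ (overlay (D k).vars ρ₁ (overlay (D' k).vars ρk ρ)) := by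
    intro k
    cases hk : sv.comp k with
    | none =>
      refine ⟨S' ⟨k, .inr k.2⟩, ρ, fun _ => [], fun b hb => (Option.some_ne_none _ hb.symm).elim,
        fun _ => ⟨rfl, rfl, rfl⟩, ?_, ?_⟩
      · intro j hj
        rw [hs.no_hole j (F.holeIdx_notMem_diff k.2 hj) fun i hi =>
          (F.disjoint_holeIdx (.inr k.2) i.2 (hnone k hk i hi).symm).notMem_of_mem_left hj]
        rfl
      -- A net outside the vector keeps its state and the values of its variables, so the relation
      -- persists.
      · rw [hs.idle ⟨k, .inr k.2⟩ hk]
        refine (hRQ k _ _ _ _ fun x _ => ?_).1 (hRk k)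
        by_cases hx : x ∈ (D k).vars
        · rw [overlay_of_mem hx, hs.post_id x fun i hi =>
            (F.disjoint_vars (.inr k.2) i.2 (hnone k hk i hi).symm).notMem_of_mem_left hx]
        · rw [overlay_of_notMem hx, overlay_eq_left fun _ _ => rfl]
    | some b =>
      obtain ⟨q₁, ρk, rk, hRk₁⟩ :=
        simQ k _ _ ρ _ _ _ _ (hRk k) (hs.child ⟨k, .inr k.2⟩ b hk)
      refine ⟨q₁, ρk, fun j => groundVis (overlay (D k).holeIdx h (fun _ => none) j), ?_,
        fun h => (Option.some_ne_none _ h).elim, ?_, ?_⟩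
      · intro b' hb'
        obtain rfl := Option.some.inj hb'
        exact rk
      · intro j hj
        exact congrArg groundVis (overlay_of_mem hj)
      · have hV : overlay (D k).vars (overlay (D k).vars ρ₁ ρ) (overlay (D' k).vars ρk ρ) =
            overlay (D k).vars ρ₁ (overlay (D' k).vars ρk ρ) :=
          overlay_congr (fun x hx => overlay_of_mem hx) fun _ _ => rfl
        rw [← hV]
        exact hRk₁
  choose q₁ ρk G hact hidle hG hRQ₁ using hsub
  have hTfin : {k : K | sv.comp k = some (tauAct A)}.Finite := by
    refine Set.Finite.of_finite_image ((F.finite sv hsv).subset ?_)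
      (f := Subtype.val) Subtype.val_injective.injOn
    rintro _ ⟨k, hk, rfl⟩
    exact ⟨k.2, fun hn => Option.some_ne_none _ (hk.symm.trans hn)⟩
  have hT : ∀ k, k ∈ hTfin.toFinset ↔ sv.comp k = some (tauAct A) := fun k => by simp
  -- A `τ` at a hole is invisible to the run answering for the node, so the nets answering a `τ` run
  -- first, with hole actions `Gs`, and reach `qm`; the remaining answers, with hole actions `Gv`,
  -- are merged into that run.
  let qm : (k : K) → (D' k).State :=
    fun k => if sv.comp k = some (tauAct A) then q₁ k else S' ⟨k, .inr k.2⟩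
  let ρm : K → Valuation A := fun k => if sv.comp k = some (tauAct A) then ρk k else ρ
  let Gs : K → Idx → List (GroundAction A) :=
    fun k => if sv.comp k = some (tauAct A) then G k else fun _ => []
  let Gv : K → Idx → List (GroundAction A) :=
    fun k => if sv.comp k = some (tauAct A) then fun _ => [] else G k
  have rs := F'.run_of_silent_runs hobs' (fun i : I' => S' ⟨i, .inl i.2⟩) ρ
    (fun k : K => S' ⟨k, .inr k.2⟩) (fun _ => ρ) hTfin.toFinset qm ρm Gs
    (fun k hk => by
      simp only [hT] at hk
      simp only [qm, ρm, Gs, if_pos hk]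
      exact hact k _ hk)
    (fun k hk => by
      simp only [hT] at hk
      simp [qm, ρm, Gs, if_neg hk])
  have rv := F'.run_of_run hobs' r (q := qm) (q₁ := q₁) (ρQ := ρm) (ρQ₁ := ρk) (G := Gv)
    (fun k => by
      rw [if_pos k.2]
      cases hk : sv.comp k with
      | none =>
        obtain ⟨h₁, h₂, h₃⟩ := hidle k hk
        have hk' : ¬ sv.comp k = some (tauAct A) := by simp [hk]
        simp only [qm, ρm, Gv, if_neg hk']
        exact ⟨h₃, h₁, h₂⟩
      | some b =>
        by_cases hb : b = tauAct A
        · have hk' : sv.comp k = some (tauAct A) := by rw [hk, hb]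
          simp only [qm, ρm, Gv, if_pos hk']
          rw [Option.map_some, groundVis_eq_nil.2 (.inr (by rw [hb, Action.eval_tauAct]))]
          exact ⟨rfl, rfl, rfl⟩
        · have hk' : ¬ sv.comp k = some (tauAct A) := by simpa [hk] using hb
          simp only [qm, ρm, Gv, if_neg hk']
          rw [Option.map_some, groundVis_of_ne fun h => hb (Action.eval_eq_groundTau.1 h)]
          exact OpenAutomaton.runs_singleton.2 (hact k b hk))
  have rall := rs.tau_append rv
  have hS' : glueState (fun i : I' => S' ⟨i, .inl i.2⟩) (fun k : K => S' ⟨k, .inr k.2⟩) = S' :=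
    glueState_restrict S'
  have hρ' : glueVal K D' ρ (fun _ => ρ) = ρ := by
    funext x
    simp only [glueVal, glue]
    split_ifs <;> rfl
  rw [hS', hρ'] at rall
  refine ⟨glueState t₁ q₁, glueVal K D' ρ₂ ρk, rall.of_hole_eq ?_, ?_, ?_⟩
  · intro j
    rw [glueHole_append]
    by_cases hex : ∃ k : K, j ∈ (D' k).holeIdx
    · obtain ⟨k, hk⟩ := hex
      rw [F'.glueHole_of_mem k hk, ← hG k j (hholes k ▸ hk)]
      simp only [Gs, Gv]
      split_ifs <;> simp
    · push Not at hex
      by_cases hjK : j ∈ K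
      · rw [glueHole_of_mem_K hjK hex, hs.no_hole j fun hj => hj.2 hjK]
        · rfl
        · rintro ⟨i, hi | hi⟩ _ hj
          · exact F.holeIdx_notMem_J hi hj (F.subset hjK)
          · exact hex ⟨i, hi⟩ (hholes ⟨i, hi⟩ ▸ hj)
      · rw [glueHole_of_notMem hjK hex, if_neg hjK, if_neg]
        · rfl
        · rintro ⟨k, hk⟩
          exact hex k (hholes k ▸ hk)
  · refine (congrArg (RP _ · _) (glueState_comp_inl F' t₁ q₁)).mpr ((hRP _ _ _ _ ?_).1 hR₁)
    intro x hx
    change overlay (node I J D srt SV).vars (overlay (node I J D srt SV).vars ρ₁ ρ)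
      (overlay (node I' J' D' srt' SV').vars ρ₂ ρ) x =
      overlay (node (I ∪ K) (J \ K) D srt SV).vars ρ₁
        (overlay (node (I' ∪ K) (J' \ K) D' srt' SV').vars (glueVal K D' ρ₂ ρk) ρ) x
    by_cases hxP : x ∈ (node I J D srt SV).vars
    · obtain ⟨i, hi, hxi⟩ := mem_vars_node.1 hxP
      rw [overlay_of_mem hxP, overlay_of_mem hxP,
        overlay_of_mem (vars_sub_subset_fill (.inl hi) hxi)]
    · have hxP' := hx.resolve_left hxP
      obtain ⟨i, hi, hxi⟩ := mem_vars_node.1 hxP'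
      have hxN' : x ∈ (node (I' ∪ K) (J' \ K) D' srt' SV').vars :=
        vars_sub_subset_fill (.inl hi) hxi
      rw [overlay_of_notMem hxP, overlay_of_mem hxP',
        overlay_of_notMem (hdisj.notMem_of_mem_right hxN'), overlay_of_mem hxN',
        F'.glueVal_of_mem_I hi hxi]
  · intro k
    refine (congrArg (RQ k _ · _) (glueState_comp_inr t₁ q₁ k)).mpr
      ((hRQ k _ _ _ _ ?_).1 (hRQ₁ k))
    intro x hx
    change _ = overlay (node (I ∪ K) (J \ K) D srt SV).vars ρ₁
        (overlay (node (I' ∪ K) (J' \ K) D' srt' SV').vars (glueVal K D' ρ₂ ρk) ρ) x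
    by_cases hxk : x ∈ (D k).vars
    · rw [overlay_of_mem hxk, overlay_of_mem (vars_sub_subset_fill (.inr k.2) hxk)]
    · have hxk' := hx.resolve_left hxk
      have hxN' : x ∈ (node (I' ∪ K) (J' \ K) D' srt' SV').vars :=
        vars_sub_subset_fill (.inr k.2) hxk'
      rw [overlay_of_notMem hxk, overlay_of_mem hxk',
        overlay_of_notMem (hdisj.notMem_of_mem_right hxN'), overlay_of_mem hxN',
        F'.glueVal_of_mem k hxk']

/-- Expresses the holes through those of the node and of the filling nets, so that equality of holes
passes to the compositions. Holes of the sub-pNets `i ∈ I` avoid `J`, hence `K`. -/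
theorem Fillable.mem_holes_fill (F : Fillable I J K D srt SV) {p : Idx × Set (ASig A)} :
    p ∈ (node (I ∪ K) (J \ K) D srt SV).holes ↔
      (p ∈ (node I J D srt SV).holes ∧ p.1 ∉ K) ∨ ∃ k : K, p ∈ (D k).holes := by
  rw [mem_holes_node, mem_holes_node]
  constructor
  · rintro (⟨⟨hJ, hK⟩, hp⟩ | ⟨i, hi | hi, hp⟩)
    · exact .inl ⟨.inl ⟨hJ, hp⟩, hK⟩
    · exact .inl ⟨.inr ⟨i, hi, hp⟩, fun hK => F.holeIdx_notMem_J hi ⟨p, hp, rfl⟩ (F.subset hK)⟩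
    · exact .inr ⟨⟨i, hi⟩, hp⟩
  · rintro (⟨⟨hJ, hp⟩ | ⟨i, hi, hp⟩, hK⟩ | ⟨k, hp⟩)
    · exact .inl ⟨⟨hJ, hK⟩, hp⟩
    · exact .inr ⟨i, .inl hi, hp⟩
    · exact .inr ⟨k, .inr k.2, hp⟩

theorem weakFHBisimilar_fill (F : Fillable I J K D srt SV) (F' : Fillable I' J' K D' srt' SV')
    (hobs : (node I J D srt SV).CannotObserveSilent)
    (hobs' : (node I' J' D' srt' SV').CannotObserveSilent)
    (hdisj : Disjoint (node (I ∪ K) (J \ K) D srt SV).vars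
      (node (I' ∪ K) (J' \ K) D' srt' SV').vars)
    (hP : WeakFHBisimilar (node I J D srt SV) (node I' J' D' srt' SV'))
    (hQ : ∀ k : K, WeakFHBisimilar (D k) (D' k)) :
    WeakFHBisimilar (node (I ∪ K) (J \ K) D srt SV) (node (I' ∪ K) (J' \ K) D' srt' SV') := by
  obtain ⟨RP, bP, initP⟩ := hP
  choose RQ bQ initQ using hQ
  have hholes : ∀ k : K, (D k).holes = (D' k).holes := fun k => (bQ k).holes_eq
  have hidx : ∀ k : K, (D k).holeIdx = (D' k).holeIdx :=
    fun k => congrArg (Prod.fst '' ·) (hholes k)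
  refine ⟨fillRel I I' K RP RQ, ⟨?_, hdisj, ?_, ?_, ?_⟩, fun ρ => ⟨initP ρ, fun k => initQ k ρ⟩⟩
  · ext p
    change p ∈ (node (I ∪ K) (J \ K) D srt SV).holes ↔
      p ∈ (node (I' ∪ K) (J' \ K) D' srt' SV').holes
    have hPh : (node I J D srt SV).holes = (node I' J' D' srt' SV').holes := bP.holes_eq
    rw [F.mem_holes_fill, F'.mem_holes_fill, hPh]
    simp only [hholes]
  · intro S S' ρ ρ' hρ
    have hsub : ∀ {i : Idx}, i ∈ I ∪ K → ∀ x ∈ (D i).vars, ρ x = ρ' x :=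
      fun hi x hx => hρ x (.inl (vars_sub_subset_fill (J := J) (srt := srt) (SV := SV) hi hx))
    have hsub' : ∀ {i : Idx}, i ∈ I' ∪ K → ∀ x ∈ (D' i).vars, ρ x = ρ' x :=
      fun hi x hx =>
        hρ x (.inr (vars_sub_subset_fill (J := J') (srt := srt') (SV := SV') hi hx))
    refine and_congr (bP.over_vars _ _ _ _ ?_) (forall_congr' fun k => (bQ k).over_vars _ _ _ _ ?_)
    · rintro x (hx | hx)
      · obtain ⟨i, hi, hx⟩ := (mem_vars_node (J := J) (srt := srt) (SV := SV)).1 hx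
        exact hsub (.inl hi) x hx
      · obtain ⟨i, hi, hx⟩ := (mem_vars_node (J := J') (srt := srt') (SV := SV')).1 hx
        exact hsub' (.inl hi) x hx
    · rintro x (hx | hx)
      · exact hsub (.inr k.2) x hx
      · exact hsub' (.inr k.2) x hx
  · exact weakSimulates_iff_groundSimulates.2 (groundSimulates_fill F F' hobs' hdisj hidx
      bP.over_vars (weakSimulates_iff_groundSimulates.1 bP.forth)
      (fun k : K => (bQ k).over_vars) fun k => weakSimulates_iff_groundSimulates.1 (bQ k).forth)
  -- The converse simulation is the same lemma with the two sides exchanged and the relations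
  -- transposed.
  · exact weakSimulates_iff_groundSimulates.2 (groundSimulates_fill F' F hobs hdisj.symm
      (fun k => (hidx k).symm) (RP := fun t s => RP s t) (RQ := fun k t s => RQ k s t)
      (fun s t ρ ρ' h => bP.over_vars t s ρ ρ' fun x hx => h x hx.symm)
      (weakSimulates_iff_groundSimulates.1 bP.back)
      (fun (k : K) s t ρ ρ' h => (bQ k).over_vars t s ρ ρ' fun x hx => h x hx.symm)
      fun k => weakSimulates_iff_groundSimulates.1 (bQ k).back)

end Fill

/-! ### Nodes depend only on their sub-pNets -/

/-- The state types differ a priori, so initial states and transitions are compared heterogeneously;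
the remaining fields are proofs. -/
theorem OpenAutomaton.eq_of_heq {B B' : OpenAutomaton.{u, v, w} A Idx} (hh : B.holes = B'.holes)
    (hS : B.St = B'.St) (hi : B.init ≍ B'.init) (hv : B.vars = B'.vars)
    (ht : B.trans ≍ B'.trans) : B = B' := by
  obtain ⟨holes, St, init, vars, trans, _, _, _⟩ := B
  obtain ⟨holes', St', init', vars', trans', _, _, _⟩ := B'
  dsimp only at hh hS hi hv ht
  subst hh hS hi hv ht
  rfl

section Congr

variable {I J : Set Idx} {sub D : Idx → PNet.{u, v, w} A Idx} {srt : Idx → Set (ASig A)}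
  {SV : Set (SyncVec A Idx)}

/-- Values of `sub` outside `I` are irrelevant. This allows a single family `D` to describe both the
node and its filling, although filling redefines the family on `K`. -/
theorem PNet.toAutomaton_node_congr (h : ∀ i ∈ I, sub i = D i) :
    (node I J sub srt SV).toAutomaton = (node I J D srt SV).toAutomaton := by
  have hf : (fun i : I => sub i) = fun i : I => D i := funext fun i => h i i.2
  have hvars : (node I J sub srt SV).vars = (node I J D srt SV).vars := by
    ext x
    rw [mem_vars_node, mem_vars_node]
    exact exists_congr fun i => and_congr_right fun hi => by rw [h i hi]
  -- Stated for families indexed by the subtype `I`, where agreement on `I` is an equality that can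
  -- be substituted.
  have key : ∀ (f g : I → PNet.{u, v, w} A Idx) (V V' : Set A.Var), f = g → V = V' →
      saturate V {t : OT A Idx ((i : I) → (f i).State) | ∃ sv ∈ SV, ∃ θ c,
        NodeRule J srt (fun i => (f i).vars) (fun i => (f i).holeIdx) (fun i => (f i).trans)
          sv θ c t} ≍
      saturate V' {t : OT A Idx ((i : I) → (g i).State) | ∃ sv ∈ SV, ∃ θ c,
        NodeRule J srt (fun i => (g i).vars) (fun i => (g i).holeIdx) (fun i => (g i).trans)
          sv θ c t} := by
    rintro f _ V _ rfl rfl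
    rfl
  have hinit : ∀ f g : I → PNet.{u, v, w} A Idx, f = g →
      (fun i => (f i).initState) ≍ (fun i => (g i).initState) := by
    rintro f _ rfl
    rfl
  refine OpenAutomaton.eq_of_heq ?_ ?_ (hinit _ _ hf) hvars ?_
  · ext p
    change p ∈ (node I J sub srt SV).holes ↔ p ∈ (node I J D srt SV).holes
    rw [mem_holes_node, mem_holes_node]
    exact or_congr_right (exists_congr fun i => and_congr_right fun hi => by rw [h i hi])
  · exact congrArg (fun f : I → PNet.{u, v, w} A Idx => ((i : I) → (f i).State)) hf
  · change (node I J sub srt SV).trans ≍ (node I J D srt SV).trans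
    rw [trans, trans]
    exact key _ _ _ _ hf hvars

theorem PNet.WF.node_congr (h : ∀ i ∈ I, sub i = D i) (hwf : (node I J sub srt SV).WF) :
    (node I J D srt SV).WF := by
  rw [WF] at hwf ⊢
  obtain ⟨h₁, h₂, h₃, h₄, h₅, h₆, h₇⟩ := hwf
  refine ⟨h₁, h₂, fun i hi => h i hi ▸ h₃ i hi,
    fun i hi i' hi' => h i hi ▸ h i' hi' ▸ h₄ i hi i' hi',
    fun i hi => h i hi ▸ h₅ i hi, fun i hi i' hi' => h i hi ▸ h i' hi' ▸ h₆ i hi i' hi',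
    fun sv hsv => ⟨fun l a hl => ?_, (h₇ sv hsv).2⟩⟩
  exact ((h₇ sv hsv).1 l a hl).imp_left fun ⟨hI, hsig⟩ => ⟨hI, h l hI ▸ hsig⟩

end Congr

theorem weakFHBisimilar_of_toAutomaton_eq {P P' N N' : PNet.{u, v, w} A Idx}
    (h : P.toAutomaton = N.toAutomaton) (h' : P'.toAutomaton = N'.toAutomaton)
    (hPP' : WeakFHBisimilar P P') : WeakFHBisimilar N N' := by
  have hB : ∃ R : P.toAutomaton.St → P'.toAutomaton.St → Pred A,
      IsWeakFHBisimulation P.toAutomaton P'.toAutomaton R ∧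
      ∀ ρ, R P.toAutomaton.init P'.toAutomaton.init ρ := hPP'
  rw [h, h'] at hB
  exact hB

theorem PNet.fill_empty (P : PNet.{u, v, w} A Idx) (Q : Idx → PNet.{u, v, w} A Idx) :
    P.fill ∅ Q = P := by
  cases P <;> simp [fill]

end

end Pnet

/-! ### Composability for arbitrary pNets -/

theorem mainTheorem6 {A : Pnet.TermAlgebra.{u}} {Idx : Type v}
    (P P' : Pnet.PNet.{u, v, w} A Idx) (hP : P.WF) (hP' : P'.WF)
    (hobs : P.CannotObserveSilent) (hobs' : P'.CannotObserveSilent)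
    (hPP' : Pnet.WeakFHBisimilar P P')
    (K : Set Idx) (hK : K ⊆ P.ownHoles) (hK' : K ⊆ P'.ownHoles)
    (hfin : ∀ sv ∈ P.vectors ∪ P'.vectors, {k ∈ K | sv.comp k ≠ none}.Finite)
    (Q Q' : Idx → Pnet.PNet.{u, v, w} A Idx)
    (hQ : ∀ k ∈ K, (Q k).WF) (hQ' : ∀ k ∈ K, (Q' k).WF)
    (hsort : ∀ k ∈ K,
      insert (Pnet.tauSig A) (Q k).sort = insert (Pnet.tauSig A) (P.ownSort k))
    (hsort' : ∀ k ∈ K,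
      insert (Pnet.tauSig A) (Q' k).sort = insert (Pnet.tauSig A) (P'.ownSort k))
    (hQQ' : ∀ k ∈ K, Pnet.WeakFHBisimilar (Q k) (Q' k))
    (hPQ : (P.fill K Q).WF) (hPQ' : (P'.fill K Q').WF)
    (hdisj : Disjoint (P.fill K Q).vars (P'.fill K Q').vars) :
    Pnet.WeakFHBisimilar (P.fill K Q) (P'.fill K Q') := by
  classical
  cases P with
  | lts L =>
    -- A pLTS has no own holes, so nothing is filled on either side.
    obtain rfl := Set.subset_empty_iff.1 hK
    rw [Pnet.PNet.fill_empty, Pnet.PNet.fill_empty]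
    exact hPP'
  | node I J sub srt SV =>
    cases P' with
    | lts L =>
      obtain rfl := Set.subset_empty_iff.1 hK'
      rw [Pnet.PNet.fill_empty, Pnet.PNet.fill_empty]
      exact hPP'
    | node I' J' sub' srt' SV' =>
      have hIK : ∀ {I J : Set Idx} {sub srt SV} {K : Set Idx},
          (Pnet.PNet.node (A := A) I J sub srt SV).WF → K ⊆ J → ∀ i ∈ I, i ∉ K := by
        intro I J sub srt SV K hwf hKJ i hi hiK
        rw [Pnet.PNet.WF] at hwf
        exact hwf.1.notMem_of_mem_left hi (hKJ hiK)
      let D : Idx → Pnet.PNet.{u, v, w} A Idx := fun i => if i ∈ K then Q i else sub i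
      let D' : Idx → Pnet.PNet.{u, v, w} A Idx := fun i => if i ∈ K then Q' i else sub' i
      have hD : ∀ i ∈ I, sub i = D i := fun i hi => (if_neg (hIK hP hK i hi)).symm
      have hD' : ∀ i ∈ I', sub' i = D' i := fun i hi => (if_neg (hIK hP' hK' i hi)).symm
      have hfill : (Pnet.PNet.node I J sub srt SV).fill K Q =
          Pnet.PNet.node (I ∪ K) (J \ K) D srt SV := by
        simp only [Pnet.PNet.fill, D]
      have hfill' : (Pnet.PNet.node I' J' sub' srt' SV').fill K Q' =
          Pnet.PNet.node (I' ∪ K) (J' \ K) D' srt' SV' := by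
        simp only [Pnet.PNet.fill, D']
      rw [hfill] at hPQ hdisj ⊢
      rw [hfill'] at hPQ' hdisj ⊢
      -- Non-observability does not mention the sub-pNets, so it applies unchanged to the nodes over
      -- `D` and `D'`.
      refine Pnet.weakFHBisimilar_fill
        ⟨hP.node_congr hD, hPQ, hK, fun sv hsv => hfin sv (.inl hsv)⟩
        ⟨hP'.node_congr hD', hPQ', hK', fun sv hsv => hfin sv (.inr hsv)⟩ hobs hobs' hdisj
        (Pnet.weakFHBisimilar_of_toAutomaton_eq (Pnet.PNet.toAutomaton_node_congr hD)
          (Pnet.PNet.toAutomaton_node_congr hD') hPP') ?_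
      intro k
      simp only [D, D', if_pos k.2]
      exact hQQ' k k.2
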